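/- Let $\mathfrak{sl}=\mathfrak{sl}(2,\mathbb C)$ with Killing form $B$, let $\sigma(x)=-x^{*}$ be the conjugation with respect to $\mathfrak{su}(2)$, let $k>0$, and put $\langle x,y\rangle=-k^{2}B(x,y)$ on $\mathfrak{sl}$, extended to $\mathfrak{sl}^{3}=\mathfrak{sl}_+\oplus\mathfrak{sl}_0\oplus\mathfrak{sl}_-$ as the orthogonal sum. Let $\mathcal O_\delta\subset\mathfrak{sl}_\delta$ ($\delta\in\{+,0,-\}$) be the nonzero nilpotent orbit and $\mathcal O_{\mathrm{reg}}=\mathcal O_+\times\mathcal O_0\times\mathcal O_-$ the regular nilpotent orbit of $\mathfrak{sl}^{3}$. On these orbits let $\xi_A$ be the vector field $X\mapsto[A,X]$, let $I\xi_A=\xi_{iA}$ be the natural complex structure, and let $\Sigma(\xi_A,\xi_B)_X=\langle[A,B],X\rangle$ be the Kirillov-Kostant-Souriau form. A hyperKähler structure $(g,I,J,K)$ with this $I$ is called compatible if $\Sigma=\omega_J+i\,\omega_K$, where $\omega_J=g(J\cdot,\cdot)$ and $\omega_K=g(K\cdot,\cdot)$; a Kähler potential of it is a smooth real function $\rho$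 with $g(I\cdot,\cdot)=i\partial\bar\partial\rho$ (with respect to $I$). Let $\eta(x)=\langle x,\sigma x\rangle$ for $x\in\mathfrak{sl}$, and $\eta_\delta(X)=\eta(X_\delta)$. Let $(g,I,J,K)$ be an $SU(2)^3$-invariant compatible hyperKähler structure on $\mathcal O_{\mathrm{reg}}$ that admits a Kähler potential. Then it is the product of $SU(2)$-invariant compatible hyperKähler structures on the factors $\mathcal O_\delta$, and there are constants $c_\delta\ge 0$ such that the metric on $\mathcal O_\delta$ is $$g_\delta(v,w)_X=\frac{\sqrt{4k^{2}\eta+c_\delta}}{\eta^{2}}\,\mathrm{Re}\Bigl(\eta\,\langle v,\sigma w\rangle-\frac{2k^{2}\eta+c_\delta}{4k^{2}\eta+c_\delta}\,\langle v,\sigma X\rangle\langle\sigma w,X\rangle\Bigr),\qquad \eta=\eta(X),\quad v,w\in T_X\mathcal O_\delta .$$ Moreover there are smooth functions $F_\delta:(0,\infty)\to\mathbb R$ with $$F_\delta'(t)^{2}=\frac{k^{2}t+c_\delta/4}{t^{2}}\qquad(t>0)$$ such that $F_\delta\circ\eta$ is a Kähler potential of the factor $\mathcal O_\delta$, and the $SU(2)^3$-invariant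 Kähler potentials of $(g,I,J,K)$ are exactly the functions $\rho=\sum_\delta F_\delta(\eta_\delta)+C$ with $C\in\mathbb R$ constant; thus $\rho_\delta=\partial\rho/\partial\eta_\delta$ satisfies $\rho_\delta^{2}=(k^{2}\eta_\delta+c_\delta/4)/\eta_\delta^{2}$. -/

import Mathlib

open scoped Matrix.Norms.Elementwise ContDiff

noncomputable section

namespace NilOrbit

/-- The complex Lie algebra `sl(2,ℂ)` of trace-free `2 × 2` matrices. -/
abbrev Sl2 := LieAlgebra.SpecialLinear.sl (Fin 2) ℂ

/-- The Lie algebra `sl(2,ℂ)^ι`, as a vector space (`ι = Fin 3` for three copies, `ι = Unit` for a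
single one).  The norm it carries is only used to speak about derivatives. -/
abbrev V (ι : Type) := ι → Sl2

/-- The adjoint action `x ↦ u x u⁻¹` of `SL(2,ℂ)` on `sl(2,ℂ)`. -/
def adj (u : Matrix.SpecialLinearGroup (Fin 2) ℂ) (x : Sl2) : Sl2 :=
  ⟨(u : Matrix (Fin 2) (Fin 2) ℂ) * (x : Matrix (Fin 2) (Fin 2) ℂ) *
      ((u⁻¹ : Matrix.SpecialLinearGroup (Fin 2) ℂ) : Matrix (Fin 2) (Fin 2) ℂ), by
    have hx : Matrix.trace (x : Matrix (Fin 2) (Fin 2) ℂ) = 0 := x.2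
    have hu : ((u⁻¹ : Matrix.SpecialLinearGroup (Fin 2) ℂ) : Matrix (Fin 2) (Fin 2) ℂ) *
        (u : Matrix (Fin 2) (Fin 2) ℂ) = 1 := by
      rw [← Matrix.SpecialLinearGroup.coe_mul]; simp
    change Matrix.trace ((u : Matrix (Fin 2) (Fin 2) ℂ) * (x : Matrix (Fin 2) (Fin 2) ℂ) *
      ((u⁻¹ : Matrix.SpecialLinearGroup (Fin 2) ℂ) : Matrix (Fin 2) (Fin 2) ℂ)) = 0
    rw [Matrix.trace_mul_comm, ← mul_assoc, hu, one_mul, hx]⟩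

/-- The conjugation `σ x = -xᴴ` of `sl(2,ℂ)` with respect to the compact real form `su(2)`. -/
def conj (x : Sl2) : Sl2 :=
  ⟨-(x : Matrix (Fin 2) (Fin 2) ℂ).conjTranspose, by
    have hx : Matrix.trace (x : Matrix (Fin 2) (Fin 2) ℂ) = 0 := x.2
    change Matrix.trace (-(x : Matrix (Fin 2) (Fin 2) ℂ).conjTranspose) = 0
    rw [Matrix.trace_neg, Matrix.trace_conjTranspose, hx, star_zero, neg_zero]⟩

/-- The nilpotent element `!![0, 1; 0, 0]` of `sl(2,ℂ)`. -/
def nilE : Sl2 := LieAlgebra.SpecialLinear.single 0 1 (by decide) 1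

variable {ι : Type}

/-- The adjoint action of `SL(2,ℂ)^ι`, factor by factor. -/
def Ad (U : ι → Matrix.SpecialLinearGroup (Fin 2) ℂ) (X : V ι) : V ι := fun d => adj (U d) (X d)

/-- `U` lies in the compact group `SU(2)^ι`. -/
def InSU2 (U : ι → Matrix.SpecialLinearGroup (Fin 2) ℂ) : Prop :=
  ∀ d, (U d : Matrix (Fin 2) (Fin 2) ℂ) ∈ Matrix.specialUnitaryGroup (Fin 2) ℂ

/-- The regular nilpotent orbit of `sl(2,ℂ)^ι`: the adjoint orbit of the element all of whose
components are equal to `nilE`. -/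
def orbit (ι : Type) : Set (V ι) :=
  {X | ∃ U : ι → Matrix.SpecialLinearGroup (Fin 2) ℂ, X = Ad U (fun _ => nilE)}

/-- The Lie bracket of `sl(2,ℂ)^ι`. -/
def br (A B : V ι) : V ι := fun d => ⁅A d, B d⁆

/-- The complex linear map `A ↦ [A, X]`. -/
def adMap (X : V ι) : V ι →ₗ[ℂ] V ι where
  toFun A := br A X
  map_add' A B := by funext d; simp [br]
  map_smul' c A := by funext d; simp [br]

/-- The tangent space `{[A, X] | A}` at `X` of the adjoint orbit through `X`. -/
def T (X : V ι) : Submodule ℂ (V ι) := LinearMap.range (adMap X)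

/-- The vector field `ξ_A` with value `[A, X]` at `X`. The fields `ξ_A` span every tangent space,
and the bracket of vector fields satisfies `[ξ_A, ξ_B] = -ξ_[A, B]`. -/
def xi (A X : V ι) : T X := ⟨br A X, A, rfl⟩

/-- The real linear endomorphism `v ↦ i v` of the tangent space: the complex structure inherited
from the embedding of the orbit into `sl(2,ℂ)^ι`. It satisfies `I ξ_A = ξ_(iA)`. -/
def natI (X : V ι) : T X →ₗ[ℝ] T X := (Complex.I • (LinearMap.id : T X →ₗ[ℂ] T X)).restrictScalars ℝ

section Calculus

variable [Fintype ι]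

/-- Derivative at the point `X` of the orbit, in the tangent direction `v`, of a function on the
orbit. (Derivatives within the orbit are unique in tangent directions.) -/
def dir (f : V ι → ℝ) (X : V ι) (v : T X) : ℝ := fderivWithin ℝ f (orbit ι) X (v : V ι)

/-- A function is smooth on the orbit, an embedded submanifold of `sl(2,ℂ)^ι`. -/
def SmoothFn (f : V ι → ℝ) : Prop := ContDiffOn ℝ ∞ f (orbit ι)

/-- A covariant 2-tensor on the orbit. -/
abbrev Tensor2 (ι : Type) := (X : V ι) → T X →ₗ[ℝ] T X →ₗ[ℝ] ℝ

/-- An endomorphism of the tangent bundle of the orbit. -/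
abbrev EndField (ι : Type) := (X : V ι) → T X →ₗ[ℝ] T X

/-- `g` is a Riemannian metric on the orbit. -/
structure IsRiemannian (g : Tensor2 ι) : Prop where
  smooth : ∀ A B : V ι, SmoothFn (fun X => g X (xi A X) (xi B X))
  symm : ∀ X ∈ orbit ι, ∀ v w : T X, g X v w = g X w v
  pos : ∀ X ∈ orbit ι, ∀ v : T X, v ≠ 0 → 0 < g X v v

/-- `D` is the Levi-Civita connection of `g`, where `D A B X` stands for the value at `X` of
`∇_{ξ_A} ξ_B`: it is torsion-free, `∇_{ξ_A} ξ_B - ∇_{ξ_B} ξ_A = [ξ_A, ξ_B] = -ξ_[A, B]`, and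
it preserves the metric. As the fields `ξ_A` span the tangent spaces, these two conditions
determine `D` by the Koszul formula. -/
structure IsLeviCivita (g : Tensor2 ι) (D : V ι → V ι → (X : V ι) → T X) : Prop where
  torsion_free : ∀ X ∈ orbit ι, ∀ A B : V ι, D A B X - D B A X = -xi (br A B) X
  metric : ∀ X ∈ orbit ι, ∀ A B C : V ι,
    dir (fun Y => g Y (xi B Y) (xi C Y)) X (xi A X) =
      g X (D A B X) (xi C X) + g X (xi B X) (D A C X)

/-- The endomorphism field `J` is smooth. -/
def SmoothEnd (J : EndField ι) : Prop :=
  ∀ A : V ι, ContDiffOn ℝ ∞ (fun X => (J X (xi A X) : V ι)) (orbit ι)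

/-- The metric `g` is Hermitian with respect to `J`. -/
def IsHermitian (g : Tensor2 ι) (J : EndField ι) : Prop :=
  ∀ X ∈ orbit ι, ∀ v w : T X, g X (J X v) (J X w) = g X v w

/-- `∇J = 0` for the Levi-Civita connection `D` of `g`. Since `∇` preserves `g`, this says
`ξ_A (g(J ξ_B, ξ_C)) = g(J ∇_{ξ_A} ξ_B, ξ_C) + g(J ξ_B, ∇_{ξ_A} ξ_C)` for all `A, B, C`. -/
def IsParallel (g : Tensor2 ι) (D : V ι → V ι → (X : V ι) → T X) (J : EndField ι) : Prop :=
  ∀ X ∈ orbit ι, ∀ A B C : V ι,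
    dir (fun Y => g Y (J Y (xi B Y)) (xi C Y)) X (xi A X) =
      g X (J X (D A B X)) (xi C X) + g X (J X (xi B X)) (D A C X)

/-- A hyperKähler structure `(g, I, J, K)` on the regular nilpotent orbit of `sl(2,ℂ)^ι`. -/
structure HyperKahler (ι : Type) [Fintype ι] where
  g : Tensor2 ι
  I : EndField ι
  J : EndField ι
  K : EndField ι
  riemannian : IsRiemannian g
  smooth_I : SmoothEnd I
  smooth_J : SmoothEnd J
  smooth_K : SmoothEnd K
  I_sq : ∀ X ∈ orbit ι, ∀ v : T X, I X (I X v) = -v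
  J_sq : ∀ X ∈ orbit ι, ∀ v : T X, J X (J X v) = -v
  I_J : ∀ X ∈ orbit ι, ∀ v : T X, I X (J X v) = K X v
  J_I : ∀ X ∈ orbit ι, ∀ v : T X, J X (I X v) = -K X v
  hermitian_I : IsHermitian g I
  hermitian_J : IsHermitian g J
  hermitian_K : IsHermitian g K
  parallel : ∃ D : V ι → V ι → (X : V ι) → T X,
    IsLeviCivita g D ∧ IsParallel g D I ∧ IsParallel g D J ∧ IsParallel g D K

/-- The invariant complex bilinear form `⟨X, Y⟩ = -k² ∑ B(X_d, Y_d)` on `sl(2,ℂ)^ι`, where `B` is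
the Killing form of `sl(2,ℂ)`. -/
def ip (k : ℝ) (X Y : V ι) : ℂ := -((k : ℂ) ^ 2 * ∑ d, killingForm ℂ Sl2 (X d) (Y d))

/-- The conjugation `σ` of `sl(2,ℂ)^ι` with respect to `su(2)^ι`. -/
def sig (X : V ι) : V ι := fun d => conj (X d)

/-- The invariant function `η(X) = ⟨X, σX⟩`, which is real-valued and nonnegative. -/
def eta (k : ℝ) (X : V ι) : ℝ := (ip k X (sig X)).re

/-- The endomorphism field `J` is invariant under `SU(2)^ι` (note `Ad_U ξ_A = ξ_{Ad_U A}`). -/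
def InvariantEnd (J : EndField ι) : Prop :=
  ∀ U : ι → Matrix.SpecialLinearGroup (Fin 2) ℂ, InSU2 U → ∀ X ∈ orbit ι, ∀ A : V ι,
    (J (Ad U X) (xi (Ad U A) (Ad U X)) : V ι) = Ad U (J X (xi A X) : V ι)

/-- The hyperKähler structure is invariant under `SU(2)^ι`. -/
def HyperKahler.IsInvariant (H : HyperKahler ι) : Prop :=
  (∀ U : ι → Matrix.SpecialLinearGroup (Fin 2) ℂ, InSU2 U → ∀ X ∈ orbit ι, ∀ A B : V ι,
    H.g (Ad U X) (xi (Ad U A) (Ad U X)) (xi (Ad U B) (Ad U X)) = H.g X (xi A X) (xi B X)) ∧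
  InvariantEnd H.I ∧ InvariantEnd H.J ∧ InvariantEnd H.K

/-- The hyperKähler structure is compatible with the Kirillov-Kostant-Souriau complex symplectic
structure of the orbit: `I` is the natural complex structure, and `Σ = ω_J + i ω_K` where
`Σ(ξ_A, ξ_B) = ⟨[A, B], X⟩`, `ω_J = g(J·, ·)` and `ω_K = g(K·, ·)`. -/
def HyperKahler.IsKKSCompatible (k : ℝ) (H : HyperKahler ι) : Prop :=
  (∀ X ∈ orbit ι, H.I X = natI X) ∧
  ∀ X ∈ orbit ι, ∀ A B : V ι,
    ip k (br A B) X =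
      (H.g X (H.J X (xi A X)) (xi B X) : ℂ) +
        Complex.I * (H.g X (H.K X (xi A X)) (xi B X) : ℂ)

/-- The 1-form `I dρ`, that is `v ↦ -dρ(I v)`. -/
def Id (I : EndField ι) (ρ : V ι → ℝ) (X : V ι) (v : T X) : ℝ := -dir ρ X (I X v)

/-- The value `(d I dρ)(ξ_A, ξ_B)` at `X`, where `dβ(ξ_A, ξ_B) = ξ_A(β(ξ_B)) - ξ_B(β(ξ_A)) -
β([ξ_A, ξ_B])` and `[ξ_A, ξ_B] = -ξ_[A, B]`. -/
def dId (I : EndField ι) (ρ : V ι → ℝ) (A B X : V ι) : ℝ :=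
  dir (fun Y => Id I ρ Y (xi B Y)) X (xi A X) - dir (fun Y => Id I ρ Y (xi A Y)) X (xi B X)
    - Id I ρ X (-xi (br A B) X)

/-- `ρ` is a Kähler potential of `(g, I)`: it is a smooth real function on the orbit with
`g(I·, ·) = i ∂ ∂̄ ρ = (1/2) d I dρ`. -/
def HyperKahler.IsKahlerPotential (H : HyperKahler ι) (ρ : V ι → ℝ) : Prop :=
  SmoothFn ρ ∧ ∀ X ∈ orbit ι, ∀ A B : V ι,
    H.g X (H.I X (xi A X)) (xi B X) = (1 / 2) * dId H.I ρ A B X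

/-- The function `ρ` on the orbit is invariant under `SU(2)^ι`. -/
def InvariantFn (ρ : V ι → ℝ) : Prop :=
  ∀ U : ι → Matrix.SpecialLinearGroup (Fin 2) ℂ, InSU2 U → ∀ X ∈ orbit ι, ρ (Ad U X) = ρ X

end Calculus

/-- The component with index `d`, as an element of a single copy of `sl(2,ℂ)`. -/
def comp (d : ι) : V ι →ₗ[ℂ] V Unit where
  toFun X := fun _ => X d
  map_add' _ _ := rfl
  map_smul' _ _ := rfl

/-- The component with index `d` of a tangent vector: the differential of the projection of the
orbit onto its factor. -/
def compT (d : ι) (X : V ι) : T X →ₗ[ℂ] T (comp d X) :=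
  (comp d).restrict (by
    rintro _ ⟨A, rfl⟩
    exact ⟨comp d A, rfl⟩)

/-- `H` is the product of the hyperKähler structures `S d` on the factors of the orbit. -/
def HyperKahler.IsProduct [Fintype ι] (H : HyperKahler ι) (S : ι → HyperKahler Unit) : Prop :=
  ∀ X ∈ orbit ι,
    (∀ v w : T X, H.g X v w = ∑ d, (S d).g (comp d X) (compT d X v) (compT d X w)) ∧
    ∀ (d : ι) (v : T X),
      compT d X (H.I X v) = (S d).I (comp d X) (compT d X v) ∧
      compT d X (H.J X v) = (S d).J (comp d X) (compT d X v) ∧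
      compT d X (H.K X v) = (S d).K (comp d X) (compT d X v)

/-- The one-parameter family of metrics on the nonzero nilpotent orbit of `sl(2,ℂ)`, evaluated at
the point `X` and the tangent vectors `v`, `w`, where `η = η(X)`:
`√(4k²η + c) / η² · Re (η ⟨v, σw⟩ - (2k²η + c) / (4k²η + c) · ⟨v, σX⟩ ⟨σw, X⟩)`. -/
def explicitMetric (k c : ℝ) (X v w : V Unit) : ℝ :=
  Real.sqrt (4 * k ^ 2 * eta k X + c) / eta k X ^ 2 *
    ((eta k X : ℂ) * ip k v (sig w) -
      (((2 * k ^ 2 * eta k X + c) / (4 * k ^ 2 * eta k X + c) : ℝ) : ℂ) *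
        (ip k v (sig X) * ip k (sig w) X)).re

end NilOrbit

end

/-!
The proof works with the spinor parametrization `z ↦ spin z` of the orbit by tuples of nonzero
vectors `z d ∈ ℂ²`. It is equivariant, its image is the orbit, and it turns derivatives within the
orbit, which is not open in `sl(2,ℂ)^ι`, into ordinary derivatives on an open set (`lieD_spin`).

*Reduction to functions of `η`.* For the natural complex structure `d I dρ` is a second order
expression in the derivatives of `ρ` along the fields `ξ_A` (`dId_eq_lieD`), hence commutes with the
average of `ρ` over `SU(2)^ι` with respect to Haar measure. As the metric is invariant, the average
of a Kähler potential is again a Kähler potential (`isKahlerPotential_avg`). The group `SU(2)`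
acts transitively on the spinors of given norm, so an invariant function is a function `f` of the
variables `η_d`, and its smoothness can be read off on an explicit slice
(`InvariantFn.eq_profile`, `contDiffOn_profile`). For `ρ = f(η)` the metric is the explicit
expression `metForm` in the first and second derivatives of `f` (`dId_comp_etas`,
`metric_eq_metForm`).

*The equations for `f`.* Compatibility gives `g(Jv, w) = Re Σ(v, w)`, so `J` is determined by `g`
and the Kirillov-Kostant-Souriau form, and the condition that `J` is an isometry is an equation
for `f`. At a point whose components are positive multiples of `!![0, 1; 0, 0]` the metric matrix
of `f` splits into a diagonal block with the entries `f_d`, and a block with the entries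
`η_d η_e f_de + δ_de η_d f_d`; the equation says that these blocks are inverse to each other up to
a diagonal factor. So `f_de = 0` for `d ≠ e`, and `2 η_d f_d (f_d + η_d f_dd) = k²`
(`potential_equations`).

*Integration.* The first equation says that `f` is a sum of functions `F_d(η_d)`
(`eq_sum_oneVar`), the second one that `(t F_d'(t))² - k² t` is a constant `c_d / 4`. This constant
is nonnegative because `(t F_d'(t))²` is, as one sees for `t → 0` (`exists_integration_constant`).

*The factors.* The metric is now an orthogonal sum of metrics on the factors, and since `J` and `K`
are determined by the metric and by `Σ`, which is also a sum, they split too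
(`isSplitEnd_of_form`). The structure on a factor, with its Levi-Civita connection, is obtained by
restriction to the slice on which the other components are equal to `nilE`
(`HyperKahler.restrict`). Finally the derivatives `f_d` of an invariant potential can be recovered
from the metric (`exists_metForm_eq_pd`), so invariant potentials are unique up to a constant.
-/

set_option linter.unusedSectionVars false

noncomputable section

namespace NilOrbit


section

/-! ### Matrix entries, the Killing form and the invariant Hermitian form -/

/-- The element `!![a, b; c, -a]` of `sl(2,ℂ)`. -/
def mk (a b c : ℂ) : Sl2 := ⟨!![a, b; c, -a], by
  change Matrix.trace !![a, b; c, -a] = 0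
  simp [Matrix.trace_fin_two]⟩

theorem entry_one_one (x : Sl2) : x.1 1 1 = -x.1 0 0 := by
  have hx : Matrix.trace x.1 = 0 := x.2
  rw [Matrix.trace_fin_two] at hx
  linear_combination hx

theorem ext_entries {x y : Sl2} (h00 : x.1 0 0 = y.1 0 0) (h01 : x.1 0 1 = y.1 0 1)
    (h10 : x.1 1 0 = y.1 1 0) : x = y := by
  apply Subtype.ext
  ext i j
  fin_cases i <;> fin_cases j
  · exact h00
  · exact h01
  · exact h10
  · simp only [Fin.mk_one, entry_one_one, h00]

@[simp] theorem mk_zero_zero (a b c : ℂ) : (mk a b c).1 0 0 = a := rfl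
@[simp] theorem mk_zero_one (a b c : ℂ) : (mk a b c).1 0 1 = b := rfl
@[simp] theorem mk_one_zero (a b c : ℂ) : (mk a b c).1 1 0 = c := rfl

@[simp] theorem lie_zero_zero (x y : Sl2) :
    (⁅x, y⁆ : Sl2).1 0 0 = x.1 0 1 * y.1 1 0 - y.1 0 1 * x.1 1 0 := by
  change (x.1 * y.1 - y.1 * x.1) 0 0 = _
  simp [Matrix.mul_apply]
  ring

@[simp] theorem lie_zero_one (x y : Sl2) :
    (⁅x, y⁆ : Sl2).1 0 1 = 2 * (x.1 0 0 * y.1 0 1 - y.1 0 0 * x.1 0 1) := by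
  change (x.1 * y.1 - y.1 * x.1) 0 1 = _
  simp [Matrix.mul_apply, entry_one_one]
  ring

@[simp] theorem lie_one_zero (x y : Sl2) :
    (⁅x, y⁆ : Sl2).1 1 0 = 2 * (x.1 1 0 * y.1 0 0 - y.1 1 0 * x.1 0 0) := by
  change (x.1 * y.1 - y.1 * x.1) 1 0 = _
  simp [Matrix.mul_apply, entry_one_one]
  ring

@[simp] theorem add_entry (x y : Sl2) (i j : Fin 2) : (x + y).1 i j = x.1 i j + y.1 i j := rfl
@[simp] theorem neg_entry (x : Sl2) (i j : Fin 2) : (-x).1 i j = -x.1 i j := rfl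
@[simp] theorem zero_entry (i j : Fin 2) : (0 : Sl2).1 i j = 0 := rfl
@[simp] theorem smul_entry (c : ℂ) (x : Sl2) (i j : Fin 2) : (c • x).1 i j = c * x.1 i j := rfl

@[simp] theorem conj_zero_zero (x : Sl2) : (conj x).1 0 0 = -star (x.1 0 0) := rfl
@[simp] theorem conj_zero_one (x : Sl2) : (conj x).1 0 1 = -star (x.1 1 0) := rfl
@[simp] theorem conj_one_zero (x : Sl2) : (conj x).1 1 0 = -star (x.1 0 1) := rfl

@[simp] theorem nilE_zero_zero : nilE.1 0 0 = 0 := by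
  simp [nilE, LieAlgebra.SpecialLinear.val_single]
@[simp] theorem nilE_zero_one : nilE.1 0 1 = 1 := by
  simp [nilE, LieAlgebra.SpecialLinear.val_single]
@[simp] theorem nilE_one_zero : nilE.1 1 0 = 0 := by
  simp [nilE, LieAlgebra.SpecialLinear.val_single]

/-- The linear coordinates `(x₀₀, x₀₁, x₁₀)` of `sl(2,ℂ)`. -/
def coords : Sl2 ≃ₗ[ℂ] (Fin 3 → ℂ) where
  toFun x := ![x.1 0 0, x.1 0 1, x.1 1 0]
  invFun u := mk (u 0) (u 1) (u 2)
  map_add' x y := by ext i; fin_cases i <;> simp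
  map_smul' c x := by ext i; fin_cases i <;> simp
  left_inv x := ext_entries rfl rfl rfl
  right_inv u := by ext i; fin_cases i <;> simp

theorem killingForm_sl2 (x y : Sl2) : killingForm ℂ Sl2 x y =
    4 * (2 * x.1 0 0 * y.1 0 0 + x.1 0 1 * y.1 1 0 + x.1 1 0 * y.1 0 1) := by
  rw [LieModule.traceForm_apply_apply,
    LinearMap.trace_eq_matrix_trace ℂ (Module.Basis.ofEquivFun coords), Matrix.trace,
    Fin.sum_univ_three]
  simp [LinearMap.toMatrix_apply, coords]
  ring

/-- The Hermitian form `⟨x, σy⟩` of `sl(2,ℂ)`, in terms of matrix entries. -/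
def herm (k : ℝ) (x y : Sl2) : ℂ :=
  4 * (k : ℂ) ^ 2 * (2 * x.1 0 0 * star (y.1 0 0) + x.1 0 1 * star (y.1 0 1)
    + x.1 1 0 * star (y.1 1 0))

variable {ι : Type}

section

variable [Fintype ι]

theorem ip_eq_sum (k : ℝ) (X Y : V ι) : ip k X Y = ∑ d, -(4 * (k : ℂ) ^ 2 *
    (2 * (X d).1 0 0 * (Y d).1 0 0 + (X d).1 0 1 * (Y d).1 1 0 + (X d).1 1 0 * (Y d).1 0 1)) := by
  rw [ip, Finset.mul_sum, ← Finset.sum_neg_distrib]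
  refine Finset.sum_congr rfl fun d _ => ?_
  rw [killingForm_sl2]
  ring

theorem ip_comm (k : ℝ) (X Y : V ι) : ip k X Y = ip k Y X := by
  rw [ip_eq_sum, ip_eq_sum]
  exact Finset.sum_congr rfl fun d _ => by ring

theorem ip_sig (k : ℝ) (X Y : V ι) : ip k X (sig Y) = ∑ d, herm k (X d) (Y d) := by
  rw [ip_eq_sum]
  refine Finset.sum_congr rfl fun d _ => ?_
  simp only [sig, herm, conj_zero_zero, conj_zero_one, conj_one_zero]
  ring

end

theorem herm_star (k : ℝ) (x y : Sl2) : star (herm k x y) = herm k y x := by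
  simp [herm, -mul_eq_mul_left_iff]
  ring

theorem herm_add_left (k : ℝ) (x y z : Sl2) : herm k (x + y) z = herm k x z + herm k y z := by
  simp [herm]
  ring

theorem herm_smul_left (k : ℝ) (c : ℂ) (x z : Sl2) : herm k (c • x) z = c * herm k x z := by
  simp [herm]
  ring

theorem herm_add_right (k : ℝ) (x y z : Sl2) : herm k z (x + y) = herm k z x + herm k z y := by
  simp [herm]
  ring

theorem herm_smul_right (k : ℝ) (c : ℂ) (x z : Sl2) :
    herm k z (c • x) = star c * herm k z x := by
  simp [herm]
  ring

theorem herm_neg_left (k : ℝ) (x z : Sl2) : herm k (-x) z = -herm k x z := by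
  simp [herm]
  ring

/-- The function `η` on a single copy of `sl(2,ℂ)`. -/
def etaOne (k : ℝ) (x : Sl2) : ℝ := (herm k x x).re

theorem etaOne_eq (k : ℝ) (x : Sl2) : etaOne k x = 4 * k ^ 2 *
    (2 * Complex.normSq (x.1 0 0) + Complex.normSq (x.1 0 1) + Complex.normSq (x.1 1 0)) := by
  have h : herm k x x = ((4 * k ^ 2 * (2 * Complex.normSq (x.1 0 0) + Complex.normSq (x.1 0 1) +
      Complex.normSq (x.1 1 0)) : ℝ) : ℂ) := by
    simp only [herm, Complex.ofReal_mul, Complex.ofReal_add, Complex.ofReal_pow,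
      ← Complex.mul_conj, Complex.star_def, Complex.ofReal_ofNat]
    ring
  rw [etaOne, h, Complex.ofReal_re]

theorem etaOne_nonneg (k : ℝ) (x : Sl2) : 0 ≤ etaOne k x := by
  rw [etaOne_eq]
  have h0 := Complex.normSq_nonneg (x.1 0 0)
  have h1 := Complex.normSq_nonneg (x.1 0 1)
  have h2 := Complex.normSq_nonneg (x.1 1 0)
  positivity

theorem etaOne_pos {k : ℝ} (hk : 0 < k) {x : Sl2} (hx : x ≠ 0) : 0 < etaOne k x := by
  refine lt_of_le_of_ne (etaOne_nonneg k x) fun h => hx ?_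
  rw [etaOne_eq] at h
  have h0 := Complex.normSq_nonneg (x.1 0 0)
  have h1 := Complex.normSq_nonneg (x.1 0 1)
  have h2 := Complex.normSq_nonneg (x.1 1 0)
  have h3 : 2 * Complex.normSq (x.1 0 0) + Complex.normSq (x.1 0 1) +
      Complex.normSq (x.1 1 0) = 0 := by
    rcases mul_eq_zero.1 h.symm with h | h
    · exact absurd h (by positivity)
    · exact h
  exact ext_entries (Complex.normSq_eq_zero.1 (by linarith)) (Complex.normSq_eq_zero.1 (by linarith))
    (Complex.normSq_eq_zero.1 (by linarith))

theorem eta_comp (k : ℝ) (d : ι) (X : V ι) : eta k (comp d X) = etaOne k (X d) := by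
  rw [eta, ip_sig]
  simp [comp, etaOne]

theorem eta_unit (k : ℝ) (X : V Unit) : eta k X = etaOne k (X ()) := by
  rw [eta, ip_sig]
  simp [etaOne]

/-! ### The spinor parametrization of the orbit -/

/-- The spinor parametrization `z ↦ !![-z₀z₁, z₀²; -z₁², z₀z₁]` of the nilpotent cone, a double
cover of the nonzero nilpotent orbit by `ℂ² ∖ {0}`. -/
def spinOne (z : Fin 2 → ℂ) : Sl2 := mk (-(z 0 * z 1)) (z 0 ^ 2) (-z 1 ^ 2)

/-- The spinor parametrization in all factors at once. -/
def spin (z : ι → Fin 2 → ℂ) : V ι := fun d => spinOne (z d)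

/-- The space of spinors on `ι` factors. -/
abbrev Spinor (ι : Type) := ι → Fin 2 → ℂ

/-- The open set of spinors all of whose components are nonzero. -/
def spinors (ι : Type) : Set (Spinor ι) := {z | ∀ d, z d ≠ 0}

/-- Factorwise action of matrices on spinors. -/
def act (M : ι → Matrix (Fin 2) (Fin 2) ℂ) (z : Spinor ι) : Spinor ι := fun d => (M d).mulVec (z d)

/-- The tuple of matrices underlying an element of `sl(2,ℂ)^ι`. -/
def mats (A : V ι) : ι → Matrix (Fin 2) (Fin 2) ℂ := fun d => (A d).1

/-- The tuple of matrices underlying an element of `SL(2,ℂ)^ι`. -/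
def slMats (U : ι → Matrix.SpecialLinearGroup (Fin 2) ℂ) : ι → Matrix (Fin 2) (Fin 2) ℂ :=
  fun d => (U d).1

theorem spinOne_mulVec (u : Matrix.SpecialLinearGroup (Fin 2) ℂ) (z : Fin 2 → ℂ) :
    spinOne (u.1.mulVec z) = adj u (spinOne z) := by
  apply ext_entries <;>
  simp [spinOne, adj, mk, Matrix.mul_apply, Matrix.mulVec, dotProduct, Fin.sum_univ_two,
    Matrix.SpecialLinearGroup.coe_inv, Matrix.adjugate_fin_two] <;> ring

theorem spin_act (U : ι → Matrix.SpecialLinearGroup (Fin 2) ℂ) (z : Spinor ι) :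
    spin (act (slMats U) z) = Ad U (spin z) :=
  funext fun d => spinOne_mulVec (U d) (z d)

theorem mulVec_ne_zero (u : Matrix.SpecialLinearGroup (Fin 2) ℂ) {z : Fin 2 → ℂ} (hz : z ≠ 0) :
    u.1.mulVec z ≠ 0 := by
  intro h
  apply hz
  have h2 : (u⁻¹ * u : Matrix.SpecialLinearGroup (Fin 2) ℂ).1.mulVec z = 0 := by
    rw [Matrix.SpecialLinearGroup.coe_mul, ← Matrix.mulVec_mulVec, h, Matrix.mulVec_zero]
  simpa using h2

theorem act_mem_spinors (U : ι → Matrix.SpecialLinearGroup (Fin 2) ℂ) {z : Spinor ι}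
    (hz : z ∈ spinors ι) : act (slMats U) z ∈ spinors ι := fun d => mulVec_ne_zero (U d) (hz d)

/-- The squared Hermitian norm `|z₀|² + |z₁|²` of a spinor. -/
def nsq (z : Fin 2 → ℂ) : ℝ := Complex.normSq (z 0) + Complex.normSq (z 1)

theorem nsq_pos {z : Fin 2 → ℂ} (hz : z ≠ 0) : 0 < nsq z := by
  have h0 := Complex.normSq_nonneg (z 0)
  have h1 := Complex.normSq_nonneg (z 1)
  refine lt_of_le_of_ne (add_nonneg h0 h1) fun h => hz ?_
  rw [nsq] at h
  refine funext (Fin.forall_fin_two.2 ⟨?_, ?_⟩)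
  · exact Complex.normSq_eq_zero.1 (by linarith)
  · exact Complex.normSq_eq_zero.1 (by linarith)

/-- The group `SU(2)` acts transitively on the spinors of given norm. -/
theorem exists_su2_mulVec {z : Fin 2 → ℂ} (hz : z ≠ 0) :
    ∃ u : Matrix.SpecialLinearGroup (Fin 2) ℂ,
      u.1 ∈ Matrix.specialUnitaryGroup (Fin 2) ℂ ∧
      u.1.mulVec ![((Real.sqrt (nsq z) : ℝ) : ℂ), 0] = z := by
  set s : ℂ := ((Real.sqrt (nsq z) : ℝ) : ℂ) with hs
  have hs2 : s * s = z 0 * star (z 0) + z 1 * star (z 1) := by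
    rw [hs, ← Complex.ofReal_mul, Real.mul_self_sqrt (nsq_pos hz).le, nsq, Complex.ofReal_add,
      ← Complex.mul_conj, ← Complex.mul_conj]
    rfl
  have hs0 : s ≠ 0 := by
    rw [hs]
    exact_mod_cast (Real.sqrt_pos.2 (nsq_pos hz)).ne'
  have hstar : (starRingEnd ℂ) s = s := Complex.conj_ofReal _
  let m : Matrix (Fin 2) (Fin 2) ℂ := !![z 0 / s, -star (z 1) / s; z 1 / s, star (z 0) / s]
  have hdet : m.det = 1 := by
    simp only [m, Matrix.det_fin_two_of]
    field_simp
    linear_combination -hs2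
  refine ⟨⟨m, hdet⟩, ?_, ?_⟩
  · rw [Matrix.mem_specialUnitaryGroup_iff, Matrix.mem_unitaryGroup_iff]
    refine ⟨?_, hdet⟩
    have hs2' : s ^ 2 = z 0 * (starRingEnd ℂ) (z 0) + z 1 * (starRingEnd ℂ) (z 1) := by
      rw [sq]; exact hs2
    ext i j
    fin_cases i <;> fin_cases j <;>
      simp [m, Matrix.mul_apply, Fin.sum_univ_two, Matrix.star_apply, hstar] <;> field_simp <;>
      first
        | linear_combination -hs2'
        | ring
  · ext i
    fin_cases i
    · simp [m, Matrix.mulVec, dotProduct, Fin.sum_univ_two, hs0]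
    · simp [m, Matrix.mulVec, dotProduct, Fin.sum_univ_two, hs0]

theorem etaOne_spinOne (k : ℝ) (z : Fin 2 → ℂ) : etaOne k (spinOne z) = 4 * k ^ 2 * nsq z ^ 2 := by
  rw [etaOne_eq, nsq]
  simp [spinOne, -mul_eq_mul_left_iff]
  ring

theorem adj_diag_nilE (s : ℂ) (hs : s ≠ 0) :
    ∃ u : Matrix.SpecialLinearGroup (Fin 2) ℂ, spinOne ![s, 0] = adj u nilE := by
  let u : Matrix.SpecialLinearGroup (Fin 2) ℂ :=
    ⟨!![s, 0; 0, s⁻¹], by simp [Matrix.det_fin_two_of, hs]⟩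
  refine ⟨u, ?_⟩
  have h : nilE = spinOne ![1, 0] := by
    apply ext_entries <;> simp [spinOne]
  rw [h, ← spinOne_mulVec]
  congr 1
  ext i
  fin_cases i <;> simp [u, Matrix.mulVec, dotProduct]

theorem adj_mul (u v : Matrix.SpecialLinearGroup (Fin 2) ℂ) (x : Sl2) :
    adj (u * v) x = adj u (adj v x) := by
  apply Subtype.ext
  simp only [adj, mul_inv_rev, Matrix.SpecialLinearGroup.coe_mul, Matrix.mul_assoc]

theorem Ad_mul (U W : ι → Matrix.SpecialLinearGroup (Fin 2) ℂ) (X : V ι) :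
    Ad (U * W) X = Ad U (Ad W X) := funext fun d => adj_mul (U d) (W d) (X d)

theorem Ad_mem_orbit (U : ι → Matrix.SpecialLinearGroup (Fin 2) ℂ) {X : V ι} (hX : X ∈ orbit ι) :
    Ad U X ∈ orbit ι := by
  obtain ⟨W, rfl⟩ := hX
  exact ⟨U * W, (Ad_mul U W _).symm⟩

theorem spin_mem_orbit {z : Spinor ι} (hz : z ∈ spinors ι) : spin z ∈ orbit ι := by
  choose u _ hu using fun d => exists_su2_mulVec (hz d)
  have hs : ∀ d, ((Real.sqrt (nsq (z d)) : ℝ) : ℂ) ≠ 0 := fun d => by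
    exact_mod_cast (Real.sqrt_pos.2 (nsq_pos (hz d))).ne'
  choose w hw using fun d => adj_diag_nilE _ (hs d)
  refine ⟨u * w, funext fun d => ?_⟩
  change spinOne (z d) = adj (u d * w d) nilE
  rw [adj_mul, ← hw, ← spinOne_mulVec, hu]

theorem exists_spin_of_mem_orbit {X : V ι} (hX : X ∈ orbit ι) : ∃ z ∈ spinors ι, spin z = X := by
  obtain ⟨U, rfl⟩ := hX
  have h : nilE = spinOne ![1, 0] := by
    apply ext_entries <;> simp [spinOne]
  refine ⟨act (slMats U) fun _ => ![1, 0], act_mem_spinors U fun d h => ?_, ?_⟩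
  · simpa using congrFun h 0
  · rw [spin_act]
    congr 1
    funext d
    exact h.symm

theorem spinOne_ne_zero {z : Fin 2 → ℂ} (hz : z ≠ 0) : spinOne z ≠ 0 := by
  intro h
  apply hz
  ext i
  fin_cases i
  · simpa [spinOne] using congrArg (fun x : Sl2 => x.1 0 1) h
  · simpa [spinOne] using congrArg (fun x : Sl2 => x.1 1 0) h

theorem ne_zero_of_mem_orbit {X : V ι} (hX : X ∈ orbit ι) (d : ι) : X d ≠ 0 := by
  obtain ⟨z, hz, rfl⟩ := exists_spin_of_mem_orbit hX
  exact spinOne_ne_zero (hz d)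

end

section

/-! ### Smooth averages over a compact space -/

section Average

open MeasureTheory Topology

variable {Q P E : Type} [TopologicalSpace Q] [CompactSpace Q] [SecondCountableTopology Q]
  [MeasurableSpace Q] [OpensMeasurableSpace Q] (μ : Measure Q) [IsFiniteMeasure μ]
  [NormedAddCommGroup P] [NormedSpace ℝ P] [NormedAddCommGroup E] [NormedSpace ℝ E]
  [ProperSpace E]

/-- The derivative of a function of two variables in the second variable. -/
def fderivSnd {P E F : Type} [NormedAddCommGroup P] [NormedSpace ℝ P] [NormedAddCommGroup E]
    [NormedSpace ℝ E] [NormedAddCommGroup F] [NormedSpace ℝ F] (G : P × E → F) (y : P × E) :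
    E →L[ℝ] F := (fderiv ℝ G y).comp (ContinuousLinearMap.inr ℝ P E)

theorem hasFDerivAt_slice {P E F : Type} [NormedAddCommGroup P] [NormedSpace ℝ P]
    [NormedAddCommGroup E] [NormedSpace ℝ E] [NormedAddCommGroup F] [NormedSpace ℝ F]
    {W : Set (P × E)} (hW : IsOpen W) {G : P × E → F} (hG : ContDiffOn ℝ ∞ G W) {p : P} {x : E}
    (h : (p, x) ∈ W) : HasFDerivAt (fun x => G (p, x)) (fderivSnd G (p, x)) x := by
  have h1 : HasFDerivAt G (fderiv ℝ G (p, x)) (p, x) :=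
    ((hG.contDiffAt (hW.mem_nhds h)).differentiableAt (by simp)).hasFDerivAt
  exact h1.comp x (hasFDerivAt_prodMk_right p x)

/-- Differentiation under the integral sign, for a family obtained from a smooth function `G`
of a parameter by letting the parameter run through the continuous image of a compact space. -/
theorem hasFDerivAt_integral_compact {F : Type} [NormedAddCommGroup F] [NormedSpace ℝ F]
    {κ : Q → P} (hκ : Continuous κ) {W : Set (P × E)} (hW : IsOpen W) {Ω : Set E} (hΩ : IsOpen Ω)
    (hmem : ∀ q, ∀ x ∈ Ω, (κ q, x) ∈ W) {G : P × E → F} (hG : ContDiffOn ℝ ∞ G W) {x : E}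
    (hx : x ∈ Ω) :
    HasFDerivAt (fun x => ∫ q, G (κ q, x) ∂μ)
      (∫ q, fderivSnd G (κ q, x) ∂μ) x := by
  obtain ⟨ε, hε, hball⟩ := Metric.nhds_basis_closedBall.mem_iff.1 (hΩ.mem_nhds hx)
  have hcont : ContinuousOn (fderiv ℝ G) W :=
    hG.continuousOn_fderiv_of_isOpen hW (by simp)
  let D : Q × E → (E →L[ℝ] F) := fun y => fderivSnd G (κ y.1, y.2)
  have hD : ContinuousOn D (Set.univ ×ˢ Ω) := by
    refine ContinuousOn.clm_comp ?_ continuousOn_const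
    exact hcont.comp (by fun_prop) fun y hy => hmem y.1 y.2 hy.2
  have hDslice : ∀ y ∈ Ω, Continuous fun q => D (q, y) := fun y hy =>
    hD.comp_continuous (by fun_prop) fun q => ⟨Set.mem_univ _, hy⟩
  have hGslice : ∀ y ∈ Ω, Continuous fun q => G (κ q, y) := fun y hy =>
    hG.continuousOn.comp_continuous (by fun_prop) fun q => hmem q y hy
  have hK : IsCompact ((Set.univ : Set Q) ×ˢ Metric.closedBall x ε) :=
    isCompact_univ.prod (isCompact_closedBall x ε)
  obtain ⟨C, hC⟩ := hK.exists_bound_of_continuousOn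
    (hD.mono (Set.prod_mono le_rfl hball))
  refine hasFDerivAt_integral_of_dominated_of_fderiv_le (F := fun x q => G (κ q, x))
    (F' := fun x q => D (q, x)) (bound := fun _ => C) (Metric.closedBall_mem_nhds x hε) ?_ ?_ ?_ ?_
    ?_ ?_
  · filter_upwards [hΩ.mem_nhds hx] with y hy using (hGslice y hy).aestronglyMeasurable
  · obtain ⟨C', hC'⟩ := (isCompact_univ (X := Q)).exists_bound_of_continuousOn
      (hGslice x hx).continuousOn
    exact Integrable.of_bound (hGslice x hx).aestronglyMeasurable C'
      (Filter.Eventually.of_forall fun q => hC' q (Set.mem_univ q))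
  · exact (hDslice x hx).aestronglyMeasurable
  · exact Filter.Eventually.of_forall fun q y hy => hC (q, y) ⟨Set.mem_univ _, hy⟩
  · exact integrable_const C
  · exact Filter.Eventually.of_forall fun q y hy => hasFDerivAt_slice hW hG (hmem q y (hball hy))

theorem contDiffOn_fderivSnd {F : Type} [NormedAddCommGroup F] [NormedSpace ℝ F]
    {W : Set (P × E)} (hW : IsOpen W) {G : P × E → F} (hG : ContDiffOn ℝ ∞ G W) :
    ContDiffOn ℝ ∞ (fderivSnd G) W :=
  (hG.fderiv_of_isOpen hW (by simp)).clm_comp contDiffOn_const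

theorem contDiffOn_integral_compact_nat (n : ℕ) {κ : Q → P} (hκ : Continuous κ) {W : Set (P × E)}
    (hW : IsOpen W) {Ω : Set E} (hΩ : IsOpen Ω) (hmem : ∀ q, ∀ x ∈ Ω, (κ q, x) ∈ W) :
    ∀ {F : Type} [NormedAddCommGroup F] [NormedSpace ℝ F] {G : P × E → F},
      ContDiffOn ℝ ∞ G W → ContDiffOn ℝ n (fun x => ∫ q, G (κ q, x) ∂μ) Ω := by
  induction n with
  | zero =>
    intro F _ _ G hG
    refine contDiffOn_zero.2 fun x hx => ?_
    exact (hasFDerivAt_integral_compact μ hκ hW hΩ hmem hG hx).continuousAt.continuousWithinAt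
  | succ n ih =>
    intro F _ _ G hG
    rw [Nat.cast_succ, contDiffOn_succ_iff_fderiv_of_isOpen hΩ]
    refine ⟨fun x hx => (hasFDerivAt_integral_compact μ hκ hW hΩ hmem hG
      hx).differentiableAt.differentiableWithinAt, by simp, ?_⟩
    refine (ih (contDiffOn_fderivSnd hW hG)).congr fun x hx => ?_
    exact (hasFDerivAt_integral_compact μ hκ hW hΩ hmem hG hx).fderiv

theorem contDiffOn_integral_compact {κ : Q → P} (hκ : Continuous κ) {W : Set (P × E)}
    (hW : IsOpen W) {Ω : Set E} (hΩ : IsOpen Ω) (hmem : ∀ q, ∀ x ∈ Ω, (κ q, x) ∈ W)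
    {F : Type} [NormedAddCommGroup F] [NormedSpace ℝ F] {G : P × E → F}
    (hG : ContDiffOn ℝ ∞ G W) : ContDiffOn ℝ ∞ (fun x => ∫ q, G (κ q, x) ∂μ) Ω :=
  contDiffOn_infty.2 fun n => contDiffOn_integral_compact_nat μ n hκ hW hΩ hmem hG

end Average

/-! ### Calculus on the orbit through the spinor parametrization -/

variable {ι : Type} [Fintype ι]

instance : IsTopologicalAddGroup Sl2 where
  continuous_add := ((continuous_subtype_val.comp continuous_fst).add
    (continuous_subtype_val.comp continuous_snd)).subtype_mk _
  continuous_neg := continuous_subtype_val.neg.subtype_mk _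

instance : ContinuousSMul ℝ Sl2 where
  continuous_smul := (continuous_fst.smul (continuous_subtype_val.comp continuous_snd)).subtype_mk _

theorem contDiff_of_coords {E : Type} [NormedAddCommGroup E] [NormedSpace ℝ E]
    {n : WithTop ℕ∞} {a b c : E → ℂ} (ha : ContDiff ℝ n a) (hb : ContDiff ℝ n b)
    (hc : ContDiff ℝ n c) : ContDiff ℝ n fun x => mk (a x) (b x) (c x) := by
  let l : (Fin 3 → ℂ) →L[ℝ] Sl2 :=
    LinearMap.toContinuousLinearMap (coords.symm.toLinearMap.restrictScalars ℝ)
  have h : ContDiff ℝ n fun x => (![a x, b x, c x] : Fin 3 → ℂ) := by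
    refine contDiff_pi.2 fun i => ?_
    fin_cases i
    · exact ha
    · exact hb
    · exact hc
  exact l.contDiff.comp h

theorem contDiff_spin {n : WithTop ℕ∞} : ContDiff ℝ n (spin : Spinor ι → V ι) := by
  refine contDiff_pi.2 fun d => ?_
  apply contDiff_of_coords <;> fun_prop

theorem isOpen_spinors : IsOpen (spinors ι) := by
  have : spinors ι = ⋂ d, {z : Spinor ι | z d ≠ 0} := by ext z; simp [spinors]
  rw [this]
  exact isOpen_iInter_of_finite fun d => isOpen_ne.preimage (continuous_apply d)

/-- The spinor parametrization intertwines the linear action of `sl(2,ℂ)^ι` on spinors with the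
adjoint action on the orbit. -/
theorem fderiv_spin_act (A : V ι) (z : Spinor ι) :
    fderiv ℝ spin z (act (mats A) z) = br A (spin z) := by
  have h1 : HasDerivAt (fun t : ℝ => spin (z + t • act (mats A) z))
      (fderiv ℝ spin z (act (mats A) z)) 0 := by
    have h := (contDiff_spin (ι := ι) (n := 1)).differentiable (by simp) z
    exact h.hasFDerivAt.hasLineDerivAt (act (mats A) z)
  have h2 : HasDerivAt (fun t : ℝ => spin (z + t • act (mats A) z)) (br A (spin z)) 0 := by
    have he : (fun t : ℝ => spin (z + t • act (mats A) z)) =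
        fun t => spin z + t • br A (spin z) + t ^ 2 • spin (act (mats A) z) := by
      funext t d
      apply ext_entries <;>
      simp [spin, spinOne, br, act, mats, Matrix.mulVec, dotProduct, Fin.sum_univ_two,
        entry_one_one, -LieSubalgebra.coe_bracket] <;> ring
    rw [he]
    have h3 := (hasDerivAt_pow 2 (0 : ℝ)).smul_const (spin (act (mats A) z))
    have h4 := ((hasDerivAt_id (0 : ℝ)).smul_const (br A (spin z))).const_add (spin z)
    exact (h4.add h3).congr_deriv (by simp)
  exact h1.unique h2

/-- The derivative of a function on the orbit along the vector field `ξ_A`. -/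
def lieD (A : V ι) (φ : V ι → ℝ) (X : V ι) : ℝ := dir φ X (xi A X)

theorem hasFDerivAt_comp_spin {F : Type} [NormedAddCommGroup F] [NormedSpace ℝ F] {φ : V ι → F}
    {φ' : V ι →L[ℝ] F} {z : Spinor ι} (hz : z ∈ spinors ι)
    (h : HasFDerivWithinAt φ φ' (orbit ι) (spin z)) :
    HasFDerivAt (φ ∘ spin) (φ'.comp (fderiv ℝ spin z)) z := by
  have h1 : HasFDerivAt spin (fderiv ℝ spin z) z :=
    ((contDiff_spin (ι := ι) (n := 1)).differentiable (by simp) z).hasFDerivAt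
  exact (h.comp z h1.hasFDerivWithinAt fun w hw => spin_mem_orbit hw).hasFDerivAt
    (isOpen_spinors.mem_nhds hz)

theorem SmoothFn.differentiableWithinAt {φ : V ι → ℝ} (hφ : SmoothFn φ) {X : V ι}
    (hX : X ∈ orbit ι) : DifferentiableWithinAt ℝ φ (orbit ι) X :=
  (hφ X hX).differentiableWithinAt (by simp)

theorem lieD_spin {φ : V ι → ℝ} {z : Spinor ι} (hz : z ∈ spinors ι)
    (hφ : DifferentiableWithinAt ℝ φ (orbit ι) (spin z)) (A : V ι) :
    lieD A φ (spin z) = fderiv ℝ (φ ∘ spin) z (act (mats A) z) := by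
  rw [(hasFDerivAt_comp_spin hz hφ.hasFDerivWithinAt).fderiv, ContinuousLinearMap.comp_apply,
    fderiv_spin_act]
  rfl

/-- Derivatives within the orbit are unique in tangent directions. -/
theorem lieD_eq_of_hasFDerivWithinAt {φ : V ι → ℝ} {φ' : V ι →L[ℝ] ℝ} {X : V ι}
    (hX : X ∈ orbit ι) (h : HasFDerivWithinAt φ φ' (orbit ι) X) (A : V ι) :
    lieD A φ X = φ' (br A X) := by
  obtain ⟨z, hz, rfl⟩ := exists_spin_of_mem_orbit hX
  rw [lieD_spin hz h.differentiableWithinAt, (hasFDerivAt_comp_spin hz h).fderiv,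
    ContinuousLinearMap.comp_apply, fderiv_spin_act]

theorem dir_congr {φ φ' : V ι → ℝ} (h : Set.EqOn φ φ' (orbit ι)) {X : V ι} (hX : X ∈ orbit ι)
    (v : T X) : dir φ X v = dir φ' X v := by
  rw [dir, dir, fderivWithin_congr h (h hX)]

theorem lieD_congr {φ φ' : V ι → ℝ} (h : Set.EqOn φ φ' (orbit ι)) {X : V ι} (hX : X ∈ orbit ι)
    (A : V ι) : lieD A φ X = lieD A φ' X := dir_congr h hX _

theorem SmoothFn.congr {φ φ' : V ι → ℝ} (hφ : SmoothFn φ) (h : Set.EqOn φ' φ (orbit ι)) :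
    SmoothFn φ' := ContDiffOn.congr hφ h

theorem contDiff_br (A : V ι) {n : WithTop ℕ∞} : ContDiff ℝ n fun X : V ι => br A X := by
  let l : V ι →ₗ[ℝ] V ι :=
    { toFun := br A
      map_add' := fun X Y => by funext d; simp [br]
      map_smul' := fun c X => by
        funext d
        exact lie_smul (c : ℂ) (A d) (X d) }
  exact (LinearMap.toContinuousLinearMap l).contDiff

/-- Derivatives along the fields `ξ_A` preserve smoothness: the derivative within the orbit need not
be continuous as a map to linear forms on the ambient space, but its values on tangent vectors agree
with those of a smooth choice of derivatives. -/
theorem SmoothFn.lieD {φ : V ι → ℝ} (hφ : SmoothFn φ) (A : V ι) : SmoothFn (lieD A φ) := by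
  intro X hX
  refine contDiffWithinAt_infty.2 fun n => ?_
  obtain ⟨u, hu, -, -, f', hf', hf⟩ := (contDiffWithinAt_succ_iff_hasFDerivWithinAt' (n := (n : ℕ∞))
    (by simp)).1 ((hφ X hX).of_le (m := ((n : ℕ∞) : WithTop ℕ∞) + 1)
      (by exact_mod_cast le_top))
  have h1 : ContDiffWithinAt ℝ n (fun Y => f' Y (br A Y)) (orbit ι) X :=
    hf.clm_apply (contDiff_br A).contDiffWithinAt
  refine h1.congr_of_eventuallyEq ?_ ?_
  · rw [Set.insert_eq_of_mem hX] at hu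
    filter_upwards [hu, self_mem_nhdsWithin] with Y hY hYo
    exact lieD_eq_of_hasFDerivWithinAt hYo (hf' Y hY) A
  · have hXu : X ∈ u := mem_of_mem_nhdsWithin (Set.mem_insert X _) hu
    exact lieD_eq_of_hasFDerivWithinAt hX (hf' X hXu) A

/-- `Ad U` as a continuous real linear map. -/
def AdL (U : ι → Matrix.SpecialLinearGroup (Fin 2) ℂ) : V ι →L[ℝ] V ι :=
  LinearMap.toContinuousLinearMap
    { toFun := Ad U
      map_add' := fun X Y => by
        funext d
        apply Subtype.ext
        simp [Ad, adj, Matrix.mul_add, Matrix.add_mul]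
      map_smul' := fun c X => by
        funext d
        apply Subtype.ext
        change (U d).1 * (c • (X d).1) * _ = c • ((U d).1 * (X d).1 * _)
        rw [Matrix.mul_smul, Matrix.smul_mul] }

theorem adj_lie (u : Matrix.SpecialLinearGroup (Fin 2) ℂ) (x y : Sl2) :
    adj u ⁅x, y⁆ = ⁅adj u x, adj u y⁆ := by
  apply Subtype.ext
  have hu : ((u⁻¹ : Matrix.SpecialLinearGroup (Fin 2) ℂ) : Matrix (Fin 2) (Fin 2) ℂ) *
      (u : Matrix (Fin 2) (Fin 2) ℂ) = 1 := by
    rw [← Matrix.SpecialLinearGroup.coe_mul]; simp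
  have key : ∀ a b : Matrix (Fin 2) (Fin 2) ℂ,
      u.1 * a * (u⁻¹).1 * (u.1 * b * (u⁻¹).1) = u.1 * (a * b) * (u⁻¹).1 := fun a b => by
    rw [show u.1 * a * (u⁻¹).1 * (u.1 * b * (u⁻¹).1) = u.1 * a * ((u⁻¹).1 * u.1) * b * (u⁻¹).1 by
      simp only [Matrix.mul_assoc], hu]
    simp only [Matrix.mul_assoc, Matrix.one_mul]
  change u.1 * (x.1 * y.1 - y.1 * x.1) * (u⁻¹).1 =
    u.1 * x.1 * (u⁻¹).1 * (u.1 * y.1 * (u⁻¹).1) - u.1 * y.1 * (u⁻¹).1 * (u.1 * x.1 * (u⁻¹).1)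
  rw [key, key, Matrix.mul_sub, Matrix.sub_mul]

theorem Ad_br (U : ι → Matrix.SpecialLinearGroup (Fin 2) ℂ) (A X : V ι) :
    Ad U (br A X) = br (Ad U A) (Ad U X) := funext fun d => adj_lie (U d) (A d) (X d)

theorem Ad_smul (U : ι → Matrix.SpecialLinearGroup (Fin 2) ℂ) (c : ℂ) (X : V ι) :
    Ad U (c • X) = c • Ad U X := by
  funext d
  apply Subtype.ext
  change (U d).1 * (c • (X d).1) * _ = c • ((U d).1 * (X d).1 * _)
  rw [Matrix.mul_smul, Matrix.smul_mul]

theorem SmoothFn.comp_Ad {φ : V ι → ℝ} (hφ : SmoothFn φ)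
    (U : ι → Matrix.SpecialLinearGroup (Fin 2) ℂ) : SmoothFn fun X => φ (Ad U X) :=
  ContDiffOn.comp hφ (AdL U).contDiff.contDiffOn fun _ hX => Ad_mem_orbit U hX

theorem lieD_comp_Ad {φ : V ι → ℝ} (hφ : SmoothFn φ)
    (U : ι → Matrix.SpecialLinearGroup (Fin 2) ℂ) (A : V ι) {X : V ι} (hX : X ∈ orbit ι) :
    lieD A (fun Y => φ (Ad U Y)) X = lieD (Ad U A) φ (Ad U X) := by
  have h1 := (hφ.differentiableWithinAt (Ad_mem_orbit U hX)).hasFDerivWithinAt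
  have h2 : HasFDerivWithinAt (Ad U) (AdL U) (orbit ι) X := (AdL U).hasFDerivAt.hasFDerivWithinAt
  have h3 : HasFDerivWithinAt (fun Y => φ (Ad U Y)) _ (orbit ι) X :=
    h1.comp X h2 fun _ hY => Ad_mem_orbit U hY
  rw [lieD_eq_of_hasFDerivWithinAt hX h3, lieD_eq_of_hasFDerivWithinAt (Ad_mem_orbit U hX) h1, ← Ad_br]
  rfl

end

section

/-! ### Averages over the compact group -/

section Average

open MeasureTheory

/-- The compact group `SU(2)`. -/
abbrev SU2 := Matrix.specialUnitaryGroup (Fin 2) ℂ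

instance : IsTopologicalGroup SU2 where
  continuous_inv := (continuous_subtype_val.matrix_conjTranspose).subtype_mk _

instance : CompactSpace SU2 := by
  refine isCompact_iff_compactSpace.1 (Metric.isCompact_of_isClosed_isBounded ?_ ?_)
  · have h : (SU2 : Set (Matrix (Fin 2) (Fin 2) ℂ)) =
        {M : Matrix (Fin 2) (Fin 2) ℂ | M * star M = 1} ∩ {M | M.det = 1} := by
      ext M
      simp [Matrix.mem_specialUnitaryGroup_iff, Matrix.mem_unitaryGroup_iff]
    rw [h]
    refine IsClosed.inter (isClosed_eq ?_ continuous_const) (isClosed_eq ?_ continuous_const)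
    · exact continuous_id.matrix_mul continuous_id.matrix_conjTranspose
    · exact continuous_id.matrix_det
  · refine (isBounded_iff_forall_norm_le).2 ⟨1, fun M hM => ?_⟩
    exact entrywise_sup_norm_bound_of_unitary hM.1

instance : SecondCountableTopology (Matrix (Fin 2) (Fin 2) ℂ) :=
  inferInstanceAs (SecondCountableTopology (Fin 2 → Fin 2 → ℂ))

instance : SecondCountableTopology SU2 := TopologicalSpace.Subtype.secondCountableTopology _

instance : MeasurableSpace SU2 := borel _

instance : BorelSpace SU2 := ⟨rfl⟩

variable {ι : Type} [Fintype ι]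

/-- The normalized Haar measure of `SU(2)^ι`. -/
def haarSU2 (ι : Type) [Fintype ι] : Measure (ι → SU2) :=
  Measure.haarMeasure (⊤ : TopologicalSpace.PositiveCompacts (ι → SU2))

instance : IsProbabilityMeasure (haarSU2 ι) := ⟨by
  have h := Measure.haarMeasure_self (K₀ := (⊤ : TopologicalSpace.PositiveCompacts (ι → SU2)))
  simpa [haarSU2] using h⟩

instance : (haarSU2 ι).IsMulLeftInvariant :=
  inferInstanceAs (Measure.haarMeasure _).IsMulLeftInvariant

/-- The inclusion of `SU(2)^ι` in `SL(2,ℂ)^ι`. -/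
def su (q : ι → SU2) : ι → Matrix.SpecialLinearGroup (Fin 2) ℂ := fun d => ⟨(q d).1, (q d).2.2⟩

theorem inSU2_su (q : ι → SU2) : InSU2 (su q) := fun d => (q d).2

theorem su_mul (q r : ι → SU2) : su (q * r) = su q * su r := rfl

theorem InSU2.exists_su {U : ι → Matrix.SpecialLinearGroup (Fin 2) ℂ} (hU : InSU2 U) :
    ∃ q, U = su q := ⟨fun d => ⟨(U d).1, hU d⟩, rfl⟩

theorem continuous_slMats_su : Continuous fun q : ι → SU2 => slMats (su q⁻¹) :=
  continuous_pi fun d => continuous_subtype_val.comp (f := fun q : ι → SU2 => (q d)⁻¹)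
    (continuous_apply d).inv

/-- The average of a function over the orbits of `SU(2)^ι`. The inverse makes invariance of the
average a consequence of the left invariance of Haar measure. -/
def avg (φ : V ι → ℝ) (X : V ι) : ℝ := ∫ q, φ (Ad (su q⁻¹) X) ∂haarSU2 ι

theorem avg_invariant (φ : V ι → ℝ) : InvariantFn (avg φ) := by
  intro U hU X _
  obtain ⟨r, rfl⟩ := hU.exists_su
  have h : ∀ q : ι → SU2, φ (Ad (su q⁻¹) (Ad (su r) X)) = φ (Ad (su (r⁻¹ * q)⁻¹) X) := fun q => by
    rw [← Ad_mul, ← su_mul, mul_inv_rev, inv_inv]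
  simp only [avg, h]
  exact integral_mul_left_eq_self (fun q => φ (Ad (su q⁻¹) X)) r⁻¹

/-- The pairs of a tuple of matrices and a spinor for which the matrices map the spinor to one with
nonzero components. -/
def actDomain (ι : Type) : Set ((ι → Matrix (Fin 2) (Fin 2) ℂ) × Spinor ι) :=
  {y | act y.1 y.2 ∈ spinors ι}

theorem contDiff_act : ContDiff ℝ ∞
    fun y : (ι → Matrix (Fin 2) (Fin 2) ℂ) × Spinor ι => act y.1 y.2 := by
  have hM : ∀ (d : ι) (i j : Fin 2), ContDiff ℝ ∞
      fun y : (ι → Matrix (Fin 2) (Fin 2) ℂ) × Spinor ι => y.1 d i j := fun d i j => by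
    have h1 : ContDiff ℝ ∞ fun y : (ι → Matrix (Fin 2) (Fin 2) ℂ) × Spinor ι => y.1 d :=
      (contDiff_apply ℝ (Matrix (Fin 2) (Fin 2) ℂ) d).comp contDiff_fst
    have h2 : ContDiff ℝ ∞ fun M : Matrix (Fin 2) (Fin 2) ℂ => M i j :=
      contDiff_apply_apply ℝ ℂ i j
    exact h2.comp h1
  have hz : ∀ (d : ι) (i : Fin 2), ContDiff ℝ ∞
      fun y : (ι → Matrix (Fin 2) (Fin 2) ℂ) × Spinor ι => y.2 d i := fun d i => by fun_prop
  refine contDiff_pi.2 fun d => contDiff_pi.2 fun i => ?_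
  have h : (fun y : (ι → Matrix (Fin 2) (Fin 2) ℂ) × Spinor ι => act y.1 y.2 d i) =
      fun y => y.1 d i 0 * y.2 d 0 + y.1 d i 1 * y.2 d 1 := by
    funext y
    simp [act, Matrix.mulVec, dotProduct, Fin.sum_univ_two]
  rw [h]
  exact ((hM d i 0).mul (hz d 0)).add ((hM d i 1).mul (hz d 1))

theorem isOpen_actDomain : IsOpen (actDomain ι) :=
  isOpen_spinors.preimage contDiff_act.continuous

theorem mem_actDomain (q : ι → SU2) {z : Spinor ι} (hz : z ∈ spinors ι) :
    (slMats (su q⁻¹), z) ∈ actDomain ι := act_mem_spinors (su q⁻¹) hz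

/-- The function `(M, z) ↦ φ(spin (M z))`, from which averages are formed. -/
def actPull (φ : V ι → ℝ) (y : (ι → Matrix (Fin 2) (Fin 2) ℂ) × Spinor ι) : ℝ :=
  φ (spin (act y.1 y.2))

theorem SmoothFn.contDiffOn_actPull {φ : V ι → ℝ} (hφ : SmoothFn φ) :
    ContDiffOn ℝ ∞ (actPull φ) (actDomain ι) :=
  ContDiffOn.comp hφ (contDiff_spin.comp contDiff_act).contDiffOn fun _ hy => spin_mem_orbit hy

theorem avg_spin (φ : V ι → ℝ) (z : Spinor ι) :
    avg φ (spin z) = ∫ q, actPull φ (slMats (su q⁻¹), z) ∂haarSU2 ι := by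
  simp only [avg, actPull, spin_act]

theorem contDiffOn_avg_spin {φ : V ι → ℝ} (hφ : SmoothFn φ) :
    ContDiffOn ℝ ∞ (avg φ ∘ spin) (spinors ι) := by
  have h := contDiffOn_integral_compact (haarSU2 ι) (continuous_slMats_su (ι := ι))
    isOpen_actDomain isOpen_spinors (fun q z hz => mem_actDomain q hz) hφ.contDiffOn_actPull
  exact h.congr fun z _ => avg_spin φ z

theorem integrable_slice {F : Type} [NormedAddCommGroup F] [SecondCountableTopology F]
    {G : (ι → Matrix (Fin 2) (Fin 2) ℂ) × Spinor ι → F} (hG : ContinuousOn G (actDomain ι))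
    {z : Spinor ι} (hz : z ∈ spinors ι) :
    Integrable (fun q => G (slMats (su q⁻¹), z)) (haarSU2 ι) := by
  have hc : Continuous fun q : ι → SU2 => G (slMats (su q⁻¹), z) :=
    hG.comp_continuous (continuous_slMats_su.prodMk continuous_const) fun q => mem_actDomain q hz
  obtain ⟨C, hC⟩ := (isCompact_univ (X := ι → SU2)).exists_bound_of_continuousOn hc.continuousOn
  exact Integrable.of_bound hc.aestronglyMeasurable C
    (Filter.Eventually.of_forall fun q => hC q (Set.mem_univ q))

/-- If the average of a family of functions is differentiable on the orbit, its derivative is the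
average of the derivatives. The family is `X ↦ G (U⁻¹, X)` with `G` smooth. -/
theorem lieD_integral {φ : V ι → ℝ} {Φ : (ι → SU2) → V ι → ℝ}
    {G : (ι → Matrix (Fin 2) (Fin 2) ℂ) × Spinor ι → ℝ} (hG : ContDiffOn ℝ ∞ G (actDomain ι))
    (hΦ : ∀ q, SmoothFn (Φ q))
    (hΦG : ∀ q, ∀ z ∈ spinors ι, Φ q (spin z) = G (slMats (su q⁻¹), z))
    (hφ : SmoothFn φ) (hφΦ : ∀ X ∈ orbit ι, φ X = ∫ q, Φ q X ∂haarSU2 ι) (A : V ι) :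
    ∃ G' : (ι → Matrix (Fin 2) (Fin 2) ℂ) × Spinor ι → ℝ, ContDiffOn ℝ ∞ G' (actDomain ι) ∧
      (∀ q, ∀ z ∈ spinors ι, lieD A (Φ q) (spin z) = G' (slMats (su q⁻¹), z)) ∧
      ∀ X ∈ orbit ι, lieD A φ X = ∫ q, lieD A (Φ q) X ∂haarSU2 ι := by
  have hD : ContDiffOn ℝ ∞ (fderivSnd G) (actDomain ι) :=
    contDiffOn_fderivSnd (P := ι → Matrix (Fin 2) (Fin 2) ℂ) (E := Spinor ι) isOpen_actDomain hG
  have hact : ContDiff ℝ ∞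
      fun y : (ι → Matrix (Fin 2) (Fin 2) ℂ) × Spinor ι => act (mats A) y.2 :=
    contDiff_act.comp (contDiff_const.prodMk contDiff_snd)
  have hslice : ∀ q, ∀ z ∈ spinors ι, lieD A (Φ q) (spin z) =
      fderivSnd G (slMats (su q⁻¹), z) (act (mats A) z) := fun q z hz => by
    rw [lieD_spin hz ((hΦ q).differentiableWithinAt (spin_mem_orbit hz))]
    have h2 := hasFDerivAt_slice (P := ι → Matrix (Fin 2) (Fin 2) ℂ) (E := Spinor ι)
      isOpen_actDomain hG (mem_actDomain q hz)
    have h3 : (Φ q ∘ spin) =ᶠ[nhds z] fun w => G (slMats (su q⁻¹), w) := by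
      filter_upwards [isOpen_spinors.mem_nhds hz] with w hw using hΦG q w hw
    rw [h3.fderiv_eq, h2.fderiv]
  refine ⟨fun y => fderivSnd G y (act (mats A) y.2), ?_, hslice, ?_⟩
  · exact ContDiffOn.clm_apply hD hact.contDiffOn
  intro X hX
  obtain ⟨z, hz, rfl⟩ := exists_spin_of_mem_orbit hX
  have h1 := hasFDerivAt_integral_compact (haarSU2 ι) (continuous_slMats_su (ι := ι))
    isOpen_actDomain isOpen_spinors (fun q z hz => mem_actDomain q hz) hG hz
  have h2 : (φ ∘ spin) =ᶠ[nhds z]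
      fun z => ∫ q, G (slMats (su q⁻¹), z) ∂haarSU2 ι := by
    filter_upwards [isOpen_spinors.mem_nhds hz] with w hw
    rw [Function.comp_apply, hφΦ _ (spin_mem_orbit hw)]
    exact integral_congr_ae (Filter.Eventually.of_forall fun q => hΦG q w hw)
  rw [lieD_spin hz (hφ.differentiableWithinAt (spin_mem_orbit hz)), h2.fderiv_eq, h1.fderiv]
  have hint : Integrable (fun q => fderivSnd G (slMats (su q⁻¹), z)) (haarSU2 ι) :=
    integrable_slice hD.continuousOn hz
  rw [ContinuousLinearMap.integral_apply hint]
  exact integral_congr_ae (Filter.Eventually.of_forall fun q => (hslice q z hz).symm)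

end Average

/-! ### Invariant functions -/

variable {ι : Type} [Fintype ι]

/-- The functions `η_d`, as a point of `ℝ^ι`. -/
def etas (k : ℝ) (X : V ι) : ι → ℝ := fun d => etaOne k (X d)

/-- The spinor with components `(a_d, 0)`, `a_d > 0`, over a point of the orbit with `η_d = t_d`. -/
def baseSpinor (k : ℝ) (t : ι → ℝ) : Spinor ι :=
  fun d => ![((Real.sqrt (Real.sqrt (t d) / (2 * k)) : ℝ) : ℂ), 0]

/-- The set of points of `ℝ^ι` with positive coordinates. -/
def pos (ι : Type) : Set (ι → ℝ) := {t | ∀ d, 0 < t d}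

theorem isOpen_pos : IsOpen (pos ι) := by
  have : pos ι = ⋂ d, {t : ι → ℝ | 0 < t d} := by ext z; simp [pos]
  rw [this]
  exact isOpen_iInter_of_finite fun d => isOpen_lt continuous_const (continuous_apply d)

theorem convex_pos : Convex ℝ (pos ι) := by
  intro x hx y hy a b ha hb hab d
  change 0 < a * x d + b * y d
  rcases ha.eq_or_lt with rfl | ha
  · have : b = 1 := by linarith
    subst this
    simpa using hy d
  · have h1 := mul_pos ha (hx d)
    have h2 := mul_nonneg hb (hy d).le
    linarith

theorem etas_mem_pos {k : ℝ} (hk : 0 < k) {X : V ι} (hX : X ∈ orbit ι) : etas k X ∈ pos ι :=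
  fun d => etaOne_pos hk (ne_zero_of_mem_orbit hX d)

theorem baseSpinor_coord_pos {k : ℝ} (hk : 0 < k) {t : ι → ℝ} (ht : t ∈ pos ι) (d : ι) :
    0 < Real.sqrt (Real.sqrt (t d) / (2 * k)) :=
  Real.sqrt_pos.2 (div_pos (Real.sqrt_pos.2 (ht d)) (by positivity))

theorem baseSpinor_mem {k : ℝ} (hk : 0 < k) {t : ι → ℝ} (ht : t ∈ pos ι) :
    baseSpinor k t ∈ spinors ι := fun d h => by
  have h1 := congrFun h 0
  simp only [baseSpinor, Matrix.cons_val_zero, Pi.zero_apply, Complex.ofReal_eq_zero] at h1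
  exact (baseSpinor_coord_pos hk ht d).ne' h1

theorem etas_spin_baseSpinor {k : ℝ} (hk : 0 < k) {t : ι → ℝ} (ht : t ∈ pos ι) :
    etas k (spin (baseSpinor k t)) = t := by
  funext d
  change etaOne k (spinOne _) = _
  rw [etaOne_spinOne, nsq]
  simp only [baseSpinor, Matrix.cons_val_zero, Matrix.cons_val_one, map_zero, add_zero,
    Complex.normSq_ofReal]
  rw [Real.mul_self_sqrt (div_nonneg (Real.sqrt_nonneg _) (by positivity)), div_pow,
    Real.sq_sqrt (ht d).le]
  field_simp
  ring

/-- An invariant function on the orbit, as a function of the variables `η_d`. -/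
def profile (k : ℝ) (φ : V ι → ℝ) (t : ι → ℝ) : ℝ := φ (spin (baseSpinor k t))

/-- An invariant function is determined by its values on the slice `baseSpinor`, as `SU(2)^ι` moves
every spinor to the slice. -/
theorem InvariantFn.eq_profile {k : ℝ} (hk : 0 < k) {φ : V ι → ℝ} (hφ : InvariantFn φ) {X : V ι}
    (hX : X ∈ orbit ι) : φ X = profile k φ (etas k X) := by
  obtain ⟨z, hz, rfl⟩ := exists_spin_of_mem_orbit hX
  choose u hu huz using fun d => exists_su2_mulVec (hz d)
  have h : baseSpinor k (etas k (spin z)) =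
      fun d => ![((Real.sqrt (nsq (z d)) : ℝ) : ℂ), 0] := by
    funext d
    have hs : Real.sqrt (etas k (spin z) d) / (2 * k) = nsq (z d) := by
      change Real.sqrt (etaOne k (spinOne (z d))) / (2 * k) = _
      rw [etaOne_spinOne, show 4 * k ^ 2 * nsq (z d) ^ 2 = (2 * k * nsq (z d)) ^ 2 by ring,
        Real.sqrt_sq (by have := nsq_pos (hz d); positivity)]
      field_simp
    rw [baseSpinor, hs]
  have hz' : z = act (slMats u) (baseSpinor k (etas k (spin z))) := by
    rw [h]
    exact funext fun d => (huz d).symm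
  rw [profile]
  conv_lhs => rw [hz', spin_act]
  exact hφ u hu _ (spin_mem_orbit (baseSpinor_mem hk (etas_mem_pos hk hX)))

theorem contDiffOn_baseSpinor {k : ℝ} (hk : 0 < k) :
    ContDiffOn ℝ ∞ (baseSpinor k : (ι → ℝ) → Spinor ι) (pos ι) := by
  refine contDiffOn_pi.2 fun d => contDiffOn_pi.2 fun i => ?_
  fin_cases i
  · have h1 : ContDiffOn ℝ ∞ (fun t : ι → ℝ => Real.sqrt (t d)) (pos ι) :=
      (contDiff_apply ℝ ℝ d).contDiffOn.sqrt fun t ht => (ht d).ne'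
    have h2 : ContDiffOn ℝ ∞ (fun t : ι → ℝ => Real.sqrt (Real.sqrt (t d) / (2 * k))) (pos ι) :=
      (h1.div_const (2 * k)).sqrt fun t ht =>
        (div_pos (Real.sqrt_pos.2 (ht d)) (by positivity)).ne'
    exact Complex.ofRealCLM.contDiff.comp_contDiffOn h2
  · exact contDiffOn_const

theorem contDiffOn_profile {k : ℝ} (hk : 0 < k) {φ : V ι → ℝ}
    (hφ : ContDiffOn ℝ ∞ (φ ∘ spin) (spinors ι)) : ContDiffOn ℝ ∞ (profile k φ) (pos ι) :=
  hφ.comp (contDiffOn_baseSpinor hk) fun _ ht => baseSpinor_mem hk ht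

theorem SmoothFn.contDiffOn_comp_spin {φ : V ι → ℝ} (hφ : SmoothFn φ) :
    ContDiffOn ℝ ∞ (φ ∘ spin) (spinors ι) :=
  ContDiffOn.comp hφ contDiff_spin.contDiffOn fun _ hz => spin_mem_orbit hz

theorem contDiff_entry (d : ι) (i j : Fin 2) {n : WithTop ℕ∞} :
    ContDiff ℝ n fun X : V ι => (X d).1 i j := by
  let l : V ι →ₗ[ℝ] ℂ :=
    { toFun := fun X => (X d).1 i j
      map_add' := fun X Y => rfl
      map_smul' := fun c X => rfl }
  exact (LinearMap.toContinuousLinearMap l).contDiff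

theorem contDiff_etas (k : ℝ) {n : WithTop ℕ∞} : ContDiff ℝ n (etas k : V ι → ι → ℝ) := by
  refine contDiff_pi.2 fun d => ?_
  have h : ∀ i j : Fin 2, ContDiff ℝ n fun X : V ι => Complex.normSq ((X d).1 i j) := fun i j => by
    simp only [Complex.normSq_apply]
    have hr := Complex.reCLM.contDiff.comp (contDiff_entry d i j (n := n))
    have hi := Complex.imCLM.contDiff.comp (contDiff_entry d i j (n := n))
    exact (hr.mul hr).add (hi.mul hi)
  simp only [etas, etaOne_eq]
  exact contDiff_const.mul (((contDiff_const.mul (h 0 0)).add (h 0 1)).add (h 1 0))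

theorem smoothFn_comp_etas {k : ℝ} (hk : 0 < k) {f : (ι → ℝ) → ℝ} (hf : ContDiffOn ℝ ∞ f (pos ι)) :
    SmoothFn fun X : V ι => f (etas k X) :=
  hf.comp (contDiff_etas k).contDiffOn fun _ hX => etas_mem_pos hk hX

/-- The average is smooth in the spinor, hence a smooth function of the `η_d`, hence smooth on the
orbit. -/
theorem smoothFn_avg {φ : V ι → ℝ} (hφ : SmoothFn φ) : SmoothFn (avg φ) :=
  (smoothFn_comp_etas one_pos (contDiffOn_profile one_pos (contDiffOn_avg_spin hφ))).congr
    fun _ hX => (avg_invariant φ).eq_profile one_pos hX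

/-! ### The average of a Kähler potential -/

theorem natI_xi (X C : V ι) : natI X (xi C X) = xi (Complex.I • C) X :=
  Subtype.ext ((adMap X).map_smul Complex.I C).symm

theorem lieD_neg {φ : V ι → ℝ} (hφ : SmoothFn φ) (A : V ι) {X : V ι} (hX : X ∈ orbit ι) :
    lieD A (fun Y => -φ Y) X = -lieD A φ X := by
  have h := (hφ.differentiableWithinAt hX).hasFDerivWithinAt
  have h' : HasFDerivWithinAt (fun Y => -φ Y) _ (orbit ι) X := h.neg
  rw [lieD_eq_of_hasFDerivWithinAt hX h', lieD_eq_of_hasFDerivWithinAt hX h]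
  rfl

/-- For the natural complex structure, the form `d I dρ` in terms of derivatives along the fields
`ξ_A`. -/
theorem dId_eq_lieD {I : EndField ι} (hI : ∀ X ∈ orbit ι, I X = natI X) {ρ : V ι → ℝ}
    (hρ : SmoothFn ρ) (A B : V ι) {X : V ι} (hX : X ∈ orbit ι) : dId I ρ A B X =
      -lieD A (lieD (Complex.I • B) ρ) X + lieD B (lieD (Complex.I • A) ρ) X
        - lieD (Complex.I • br A B) ρ X := by
  have hId : ∀ C : V ι, Set.EqOn (fun Y => Id I ρ Y (xi C Y))
      (fun Y => -lieD (Complex.I • C) ρ Y) (orbit ι) := by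
    intro C Y hY
    simp only [Id]
    rw [hI Y hY, natI_xi, lieD]
  have h1 : ∀ C D : V ι, dir (fun Y => Id I ρ Y (xi C Y)) X (xi D X) =
      -lieD D (lieD (Complex.I • C) ρ) X := fun C D => by
    rw [dir_congr (hId C) hX]
    exact lieD_neg (hρ.lieD _) D hX
  have h2 : Id I ρ X (-xi (br A B) X) = lieD (Complex.I • br A B) ρ X := by
    rw [Id, map_neg, hI X hX, natI_xi]
    change -(fderivWithin ℝ ρ (orbit ι) X (-(xi (Complex.I • br A B) X : V ι))) = _
    rw [map_neg, neg_neg]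
    rfl
  rw [dId, h1, h1, h2]
  ring

theorem dId_comp_Ad {I : EndField ι} (hI : ∀ X ∈ orbit ι, I X = natI X) {ρ : V ι → ℝ}
    (hρ : SmoothFn ρ) (U : ι → Matrix.SpecialLinearGroup (Fin 2) ℂ) (A B : V ι) {X : V ι}
    (hX : X ∈ orbit ι) :
    dId I (fun Y => ρ (Ad U Y)) A B X = dId I ρ (Ad U A) (Ad U B) (Ad U X) := by
  have h : ∀ C D : V ι, lieD C (lieD D fun Y => ρ (Ad U Y)) X =
      lieD (Ad U C) (lieD (Ad U D) ρ) (Ad U X) := fun C D => by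
    rw [← lieD_comp_Ad (hρ.lieD _) U C hX]
    exact lieD_congr (fun Y hY => lieD_comp_Ad hρ U D hY) hX C
  rw [dId_eq_lieD hI (hρ.comp_Ad U) A B hX, dId_eq_lieD hI hρ _ _ (Ad_mem_orbit U hX), h, h,
    lieD_comp_Ad hρ U _ hX, Ad_smul, Ad_smul, Ad_smul, Ad_br]

/-- The operator `d I d` commutes with averages over `SU(2)^ι`. -/
theorem dId_avg {I : EndField ι} (hI : ∀ X ∈ orbit ι, I X = natI X) {ρ : V ι → ℝ}
    (hρ : SmoothFn ρ) (A B : V ι) {X : V ι} (hX : X ∈ orbit ι) :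
    dId I (avg ρ) A B X =
      ∫ q, dId I ρ (Ad (su q⁻¹) A) (Ad (su q⁻¹) B) (Ad (su q⁻¹) X) ∂haarSU2 ι := by
  have hq : ∀ q : ι → SU2, SmoothFn fun Y => ρ (Ad (su q⁻¹) Y) := fun q => hρ.comp_Ad _
  obtain ⟨z, hz, rfl⟩ := exists_spin_of_mem_orbit hX
  have first : ∀ C : V ι, _ := fun C =>
    lieD_integral (φ := avg ρ) hρ.contDiffOn_actPull hq
      (fun q z _ => by simp only [actPull, spin_act]) (smoothFn_avg hρ) (fun _ _ => rfl) C
  have hint : ∀ {G : (ι → Matrix (Fin 2) (Fin 2) ℂ) × Spinor ι → ℝ} {Φ : (ι → SU2) → ℝ},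
      ContDiffOn ℝ ∞ G (actDomain ι) → (∀ q, Φ q = G (slMats (su q⁻¹), z)) →
      MeasureTheory.Integrable Φ (haarSU2 ι) := by
    intro G Φ hG hΦ
    rw [funext hΦ]
    exact integrable_slice hG.continuousOn hz
  have second : ∀ C D : V ι,
      MeasureTheory.Integrable
        (fun q => lieD C (lieD D fun Y => ρ (Ad (su q⁻¹) Y)) (spin z)) (haarSU2 ι) ∧
      lieD C (lieD D (avg ρ)) (spin z) =
        ∫ q, lieD C (lieD D fun Y => ρ (Ad (su q⁻¹) Y)) (spin z) ∂haarSU2 ι := fun C D => by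
    obtain ⟨G, hG, hGeq, havg⟩ := first D
    obtain ⟨G', hG', hGeq', havg'⟩ := lieD_integral hG (fun q => (hq q).lieD D) hGeq
      ((smoothFn_avg hρ).lieD D) havg C
    exact ⟨hint hG' fun q => hGeq' q z hz, havg' _ hX⟩
  obtain ⟨G, hG, hGeq, havg⟩ := first (Complex.I • br A B)
  have i3 := hint hG fun q => hGeq q z hz
  obtain ⟨i1, e1⟩ := second A (Complex.I • B)
  obtain ⟨i2, e2⟩ := second B (Complex.I • A)
  have s1 := MeasureTheory.integral_neg (μ := haarSU2 ι)
    fun q => lieD A (lieD (Complex.I • B) fun Y => ρ (Ad (su q⁻¹) Y)) (spin z)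
  have s2 := MeasureTheory.integral_add i1.neg i2
  have s3 := MeasureTheory.integral_sub (i1.neg.add i2) i3
  simp only [Pi.neg_apply, Pi.add_apply] at s2 s3
  rw [dId_eq_lieD hI (smoothFn_avg hρ) A B hX, e1, e2, havg _ hX, ← s1, ← s2, ← s3]
  refine MeasureTheory.integral_congr_ae (Filter.Eventually.of_forall fun q => ?_)
  exact (dId_eq_lieD hI (hq q) A B hX).symm.trans (dId_comp_Ad hI hρ _ A B hX)

/-- An invariant hyperKähler structure with a Kähler potential has an invariant one, the average of
the given potential. -/
theorem isKahlerPotential_avg (H : HyperKahler ι) (hinv : H.IsInvariant)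
    (hI : ∀ X ∈ orbit ι, H.I X = natI X) {ρ : V ι → ℝ} (hρ : H.IsKahlerPotential ρ) :
    H.IsKahlerPotential (avg ρ) := by
  refine ⟨smoothFn_avg hρ.1, fun X hX A B => ?_⟩
  rw [dId_avg hI hρ.1 A B hX]
  have h : ∀ q : ι → SU2, dId H.I ρ (Ad (su q⁻¹) A) (Ad (su q⁻¹) B) (Ad (su q⁻¹) X) =
      2 * H.g X (H.I X (xi A X)) (xi B X) := fun q => by
    have h1 := hρ.2 _ (Ad_mem_orbit (su q⁻¹) hX) (Ad (su q⁻¹) A) (Ad (su q⁻¹) B)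
    rw [hI _ (Ad_mem_orbit (su q⁻¹) hX), natI_xi, ← Ad_smul,
      hinv.1 _ (inSU2_su q⁻¹) X hX] at h1
    rw [hI X hX, natI_xi]
    linarith
  simp only [h, MeasureTheory.integral_const, MeasureTheory.probReal_univ, one_smul]
  ring

end

section

/-! ### The form `d I dρ` of a function of the variables `η_d` -/

variable {ι : Type} [Fintype ι] [DecidableEq ι]

/-- The partial derivative of a function on `ℝ^ι`. -/
def pd (d : ι) (f : (ι → ℝ) → ℝ) (t : ι → ℝ) : ℝ := fderiv ℝ f t (Pi.single d 1)

theorem fderiv_eq_sum_pd (f : (ι → ℝ) → ℝ) (t u : ι → ℝ) :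
    fderiv ℝ f t u = ∑ d, pd d f t * u d := by
  conv_lhs => rw [pi_eq_sum_univ u, map_sum]
  refine Finset.sum_congr rfl fun d _ => ?_
  rw [map_smul, smul_eq_mul, mul_comm, pd]
  congr 2
  funext j
  simp [Pi.single_apply, eq_comm]

theorem contDiffOn_pd {f : (ι → ℝ) → ℝ} (hf : ContDiffOn ℝ ∞ f (pos ι)) (d : ι) :
    ContDiffOn ℝ ∞ (pd d f) (pos ι) :=
  (hf.fderiv_of_isOpen isOpen_pos (by simp)).clm_apply contDiffOn_const

theorem hasFDerivAt_of_contDiffOn_pos {f : (ι → ℝ) → ℝ} (hf : ContDiffOn ℝ ∞ f (pos ι)) {t : ι → ℝ}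
    (ht : t ∈ pos ι) : HasFDerivAt f (fderiv ℝ f t) t :=
  ((hf.contDiffAt (isOpen_pos.mem_nhds ht)).differentiableAt (by simp)).hasFDerivAt

theorem hasDerivAt_quadratic (a b c : ℝ) : HasDerivAt (fun t : ℝ => a + t * b + t ^ 2 * c) b 0 := by
  have h := (((hasDerivAt_id (0 : ℝ)).mul_const b).const_add a).add
    ((hasDerivAt_pow 2 (0 : ℝ)).mul_const c)
  exact h.congr_deriv (by simp)

theorem herm_real_smul_left (k t : ℝ) (x y : Sl2) : herm k (t • x) y = t * herm k x y :=
  herm_smul_left k (t : ℂ) x y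

theorem herm_real_smul_right (k t : ℝ) (x y : Sl2) : herm k x (t • y) = t * herm k x y := by
  have h := herm_smul_right k (t : ℂ) y x
  simpa using h

theorem herm_re_comm (k : ℝ) (x y : Sl2) : (herm k x y).re = (herm k y x).re := by
  rw [← herm_star]
  rfl

theorem hasDerivAt_etas_line (k : ℝ) (X v : V ι) :
    HasDerivAt (fun t : ℝ => etas k (X + t • v)) (fun d => 2 * (herm k (v d) (X d)).re) 0 := by
  refine hasDerivAt_pi.2 fun d => ?_
  have h : (fun t : ℝ => etas k (X + t • v) d) = fun t : ℝ => (herm k (X d) (X d)).re +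
      t * (2 * (herm k (v d) (X d)).re) + t ^ 2 * (herm k (v d) (v d)).re := by
    funext t
    simp only [etas, etaOne, Pi.add_apply, Pi.smul_apply, herm_add_left, herm_add_right,
      herm_real_smul_left, herm_real_smul_right, Complex.add_re, Complex.re_ofReal_mul]
    rw [herm_re_comm k (X d) (v d)]
    ring
  rw [h]
  exact hasDerivAt_quadratic _ _ _

/-- For a function given near a point of the orbit in the ambient space, the derivative along `ξ_A`
can be computed along a straight line. -/
theorem lieD_eq_of_line {Φ : V ι → ℝ} {X : V ι} (hX : X ∈ orbit ι) (hΦ : DifferentiableAt ℝ Φ X)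
    {A : V ι} {m : ℝ} (h : HasDerivAt (fun t : ℝ => Φ (X + t • br A X)) m 0) : lieD A Φ X = m := by
  rw [lieD_eq_of_hasFDerivWithinAt hX hΦ.hasFDerivAt.hasFDerivWithinAt]
  exact (hΦ.hasFDerivAt.hasLineDerivAt (br A X)).unique h

theorem differentiableAt_comp_etas {k : ℝ} (hk : 0 < k) {f : (ι → ℝ) → ℝ}
    (hf : ContDiffOn ℝ ∞ f (pos ι)) {X : V ι} (hX : X ∈ orbit ι) :
    DifferentiableAt ℝ (fun Y => f (etas k Y)) X :=
  (hasFDerivAt_of_contDiffOn_pos hf (etas_mem_pos hk hX)).differentiableAt.comp X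
    ((contDiff_etas k (n := 1)).differentiable (by simp) X)

theorem hasDerivAt_comp_etas_line {k : ℝ} (hk : 0 < k) {f : (ι → ℝ) → ℝ}
    (hf : ContDiffOn ℝ ∞ f (pos ι)) {X : V ι} (hX : X ∈ orbit ι) (v : V ι) :
    HasDerivAt (fun t : ℝ => f (etas k (X + t • v)))
      (∑ d, pd d f (etas k X) * (2 * (herm k (v d) (X d)).re)) 0 := by
  have h1 : HasFDerivAt f (fderiv ℝ f (etas k X)) (etas k (X + (0 : ℝ) • v)) := by
    rw [zero_smul, add_zero]
    exact hasFDerivAt_of_contDiffOn_pos hf (etas_mem_pos hk hX)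
  have h2 := h1.comp_hasDerivAt (0 : ℝ) (hasDerivAt_etas_line k X v)
  rw [fderiv_eq_sum_pd] at h2
  exact h2

theorem lieD_comp_etas {k : ℝ} (hk : 0 < k) {f : (ι → ℝ) → ℝ} (hf : ContDiffOn ℝ ∞ f (pos ι))
    {X : V ι} (hX : X ∈ orbit ι) (A : V ι) : lieD A (fun Y => f (etas k Y)) X =
      ∑ d, pd d f (etas k X) * (2 * (herm k (br A X d) (X d)).re) :=
  lieD_eq_of_line hX (differentiableAt_comp_etas hk hf hX)
    (hasDerivAt_comp_etas_line hk hf hX _)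

theorem differentiable_herm_br (k : ℝ) (B : V ι) (d : ι) :
    Differentiable ℝ fun Y : V ι => 2 * (herm k (br B Y d) (Y d)).re := by
  have he : ∀ i j : Fin 2, Differentiable ℝ fun Y : V ι => (Y d).1 i j := fun i j =>
    (contDiff_entry d i j (n := 1)).differentiable (by simp)
  have hs : ∀ i j : Fin 2, Differentiable ℝ fun Y : V ι => star ((Y d).1 i j) := fun i j =>
    Complex.conjCLE.differentiable.comp (he i j)
  have hb : ∀ i j : Fin 2, Differentiable ℝ fun Y : V ι => (br B Y d).1 i j := fun i j =>
    ((contDiff_entry d i j (n := 1)).comp (contDiff_br B)).differentiable (by simp)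
  have h : Differentiable ℝ fun Y : V ι => herm k (br B Y d) (Y d) := by
    simp only [herm, mul_assoc]
    exact ((((((hb 0 0).mul (hs 0 0)).const_mul 2).add ((hb 0 1).mul (hs 0 1))).add
      ((hb 1 0).mul (hs 1 0))).const_mul _).const_mul _
  exact (Complex.reCLM.differentiable.comp h).const_mul 2

theorem hasDerivAt_herm_br_line (k : ℝ) (X v B : V ι) (d : ι) :
    HasDerivAt (fun t : ℝ => 2 * (herm k (br B (X + t • v) d) ((X + t • v) d)).re)
      (2 * ((herm k (br B v d) (X d)).re + (herm k (br B X d) (v d)).re)) 0 := by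
  have h : (fun t : ℝ => 2 * (herm k (br B (X + t • v) d) ((X + t • v) d)).re) = fun t : ℝ =>
      2 * (herm k (br B X d) (X d)).re +
      t * (2 * ((herm k (br B v d) (X d)).re + (herm k (br B X d) (v d)).re)) +
      t ^ 2 * (2 * (herm k (br B v d) (v d)).re) := by
    funext t
    have hb : br B (X + t • v) d = br B X d + t • br B v d := by
      change ⁅B d, X d + (t : ℂ) • v d⁆ = ⁅B d, X d⁆ + (t : ℂ) • ⁅B d, v d⁆
      rw [lie_add, lie_smul]
    simp only [hb, Pi.add_apply, Pi.smul_apply, herm_add_left, herm_add_right,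
      herm_real_smul_left, herm_real_smul_right, Complex.add_re, Complex.re_ofReal_mul]
    ring
  rw [h]
  exact hasDerivAt_quadratic _ _ _

theorem lieD_lieD_comp_etas {k : ℝ} (hk : 0 < k) {f : (ι → ℝ) → ℝ} (hf : ContDiffOn ℝ ∞ f (pos ι))
    {X : V ι} (hX : X ∈ orbit ι) (A B : V ι) : lieD A (lieD B fun Y => f (etas k Y)) X =
      ∑ d, ((∑ e, pd e (pd d f) (etas k X) * (2 * (herm k (br A X e) (X e)).re)) *
          (2 * (herm k (br B X d) (X d)).re) +
        pd d f (etas k X) * (2 * ((herm k (br B (br A X) d) (X d)).re +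
          (herm k (br B X d) (br A X d)).re))) := by
  rw [lieD_congr (fun Y hY => lieD_comp_etas hk hf hY B) hX]
  refine lieD_eq_of_line hX ?_ ?_
  · exact DifferentiableAt.fun_sum fun d _ =>
      (differentiableAt_comp_etas hk (contDiffOn_pd hf d) hX).mul (differentiable_herm_br k B d X)
  · refine HasDerivAt.fun_sum fun d _ => ?_
    have h1 := (hasDerivAt_comp_etas_line hk (contDiffOn_pd hf d) hX (br A X)).mul
      (hasDerivAt_herm_br_line k X (br A X) B d)
    simp only [zero_smul, add_zero] at h1
    exact h1

/-- The value of `(1/2) d I dρ`, for `ρ = f(η)`, on two tangent vectors `v`, `w` at `X`. -/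
def potForm (k : ℝ) (f : (ι → ℝ) → ℝ) (X v w : V ι) : ℝ :=
  2 * ∑ d, pd d f (etas k X) * (herm k (w d) (v d)).im +
  2 * ∑ d, ∑ e, pd e (pd d f) (etas k X) *
    ((herm k (v e) (X e)).re * (herm k (w d) (X d)).im -
      (herm k (w e) (X e)).re * (herm k (v d) (X d)).im)

theorem dId_comp_etas {k : ℝ} (hk : 0 < k) {I : EndField ι} (hI : ∀ X ∈ orbit ι, I X = natI X)
    {f : (ι → ℝ) → ℝ} (hf : ContDiffOn ℝ ∞ f (pos ι)) (A B : V ι) {X : V ι} (hX : X ∈ orbit ι) :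
    (1 / 2) * dId I (fun Y => f (etas k Y)) A B X = potForm k f X (br A X) (br B X) := by
  have hsmul : ∀ C Y : V ι, ∀ d, br (Complex.I • C) Y d = Complex.I • br C Y d := fun C Y d =>
    smul_lie Complex.I (C d) (Y d)
  have hre : ∀ (C Y : V ι) (d : ι) (z : Sl2),
      (herm k (br (Complex.I • C) Y d) z).re = -(herm k (br C Y d) z).im := fun C Y d z => by
    rw [hsmul, herm_smul_left, Complex.I_mul_re]
  have hjac : ∀ d, br (br A B) X d = br A (br B X) d - br B (br A X) d := fun d =>
    lie_lie (A d) (B d) (X d)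
  have hsub : ∀ x y z : Sl2, herm k (x - y) z = herm k x z - herm k y z := fun x y z => by
    rw [sub_eq_add_neg, herm_add_left, herm_neg_left, sub_eq_add_neg]
  have him : ∀ x y : Sl2, (herm k x y).im = -(herm k y x).im := fun x y => by
    rw [← herm_star]
    rfl
  rw [dId_eq_lieD hI (smoothFn_comp_etas hk hf) A B hX, lieD_lieD_comp_etas hk hf hX,
    lieD_lieD_comp_etas hk hf hX, lieD_comp_etas hk hf hX]
  simp only [hre, hjac, hsub, Complex.sub_im]
  rw [potForm, ← Finset.sum_neg_distrib, ← Finset.sum_add_distrib, ← Finset.sum_sub_distrib,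
    Finset.mul_sum, Finset.mul_sum, Finset.mul_sum, ← Finset.sum_add_distrib]
  refine Finset.sum_congr rfl fun d _ => ?_
  rw [him (br A X d) (br B X d)]
  simp only [mul_sub, Finset.sum_sub_distrib, Finset.sum_mul, Finset.mul_sum]
  have h1 : ∀ a b : ι → Sl2,
      ∑ e, pd e (pd d f) (etas k X) * (2 * (herm k (a e) (X e)).re) * (2 * -(herm k (b d) (X d)).im)
      = -4 * ∑ e, pd e (pd d f) (etas k X) *
        ((herm k (a e) (X e)).re * (herm k (b d) (X d)).im) := fun a b => by
    rw [Finset.mul_sum]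
    exact Finset.sum_congr rfl fun e _ => by ring
  rw [h1, h1]
  simp only [← Finset.mul_sum]
  ring

end

section

/-! ### The equations for an invariant potential -/

variable {ι : Type} [Fintype ι] [DecidableEq ι]

/-- The metric with Kähler potential `f(η)`, on two tangent vectors `v`, `w` at `X`. -/
def metForm (k : ℝ) (f : (ι → ℝ) → ℝ) (X v w : V ι) : ℝ :=
  2 * ∑ d, pd d f (etas k X) * (herm k (w d) (v d)).re +
  2 * ∑ d, ∑ e, pd e (pd d f) (etas k X) *
    ((herm k (v e) (X e)).im * (herm k (w d) (X d)).im +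
      (herm k (w e) (X e)).re * (herm k (v d) (X d)).re)

theorem potForm_I_smul (k : ℝ) (f : (ι → ℝ) → ℝ) (X v w : V ι) :
    potForm k f X (-(Complex.I • v)) w = metForm k f X v w := by
  have h1 : ∀ d, herm k ((-(Complex.I • v)) d) (X d) = -(Complex.I * herm k (v d) (X d)) :=
    fun d => by
      rw [Pi.neg_apply, Pi.smul_apply, herm_neg_left, herm_smul_left]
  have h2 : ∀ d, herm k (w d) ((-(Complex.I • v)) d) = Complex.I * herm k (w d) (v d) :=
    fun d => by
      rw [← herm_star, Pi.neg_apply, Pi.smul_apply, herm_neg_left, herm_smul_left, star_neg,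
        star_mul', herm_star]
      simp
  simp [potForm, metForm, h1, h2, -Pi.neg_apply, -Pi.smul_apply]

theorem exists_xi {X : V ι} (v : T X) : ∃ A, v = xi A X := by
  obtain ⟨_, A, rfl⟩ := v
  exact ⟨A, rfl⟩

theorem metric_eq_metForm {k : ℝ} (hk : 0 < k) {H : HyperKahler ι}
    (hI : ∀ X ∈ orbit ι, H.I X = natI X) {f : (ι → ℝ) → ℝ} (hf : ContDiffOn ℝ ∞ f (pos ι))
    (hpot : H.IsKahlerPotential fun X => f (etas k X)) {X : V ι} (hX : X ∈ orbit ι) (v w : T X) :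
    H.g X v w = metForm k f X v w := by
  obtain ⟨A, rfl⟩ := exists_xi v
  obtain ⟨B, rfl⟩ := exists_xi w
  have hmul : br (-(Complex.I • A)) X = -(Complex.I • br A X) := by
    funext d
    change ⁅-(Complex.I • A d), X d⁆ = -(Complex.I • ⁅A d, X d⁆)
    rw [neg_lie, smul_lie]
  have hv : H.I X (xi (-(Complex.I • A)) X) = xi A X := by
    rw [hI X hX]
    apply Subtype.ext
    change Complex.I • br (-(Complex.I • A)) X = br A X
    rw [hmul, smul_neg, smul_smul, Complex.I_mul_I, neg_smul, one_smul, neg_neg]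
  have h := hpot.2 X hX (-(Complex.I • A)) B
  rw [hv, dId_comp_etas hk hI hf _ _ hX, hmul, potForm_I_smul] at h
  exact h

@[simp] theorem herm_zero_left (k : ℝ) (x : Sl2) : herm k 0 x = 0 := by simp [herm]

@[simp] theorem herm_zero_right (k : ℝ) (x : Sl2) : herm k x 0 = 0 := by simp [herm]

theorem metForm_single (k : ℝ) (f : (ι → ℝ) → ℝ) (X v : V ι) (m : ι) (x : Sl2) :
    metForm k f X v (Pi.single m x) = 2 * (pd m f (etas k X) * (herm k x (v m)).re) +
      2 * (∑ e, pd e (pd m f) (etas k X) * (herm k (v e) (X e)).im) * (herm k x (X m)).im +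
      2 * (∑ d, pd m (pd d f) (etas k X) * (herm k (v d) (X d)).re) * (herm k x (X m)).re := by
  have hz : ∀ (d : ι) (y : Sl2), d ≠ m → herm k ((Pi.single m x : V ι) d) y = 0 := fun d y h => by
    rw [Pi.single_eq_of_ne h, herm_zero_left]
  have h1 : ∑ d, pd d f (etas k X) * (herm k ((Pi.single m x : V ι) d) (v d)).re =
      pd m f (etas k X) * (herm k x (v m)).re := by
    rw [Finset.sum_eq_single m (fun d _ h => by simp [hz d _ h]) (by simp), Pi.single_eq_same]
  have h2 : ∑ d, ∑ e, pd e (pd d f) (etas k X) * ((herm k (v e) (X e)).im *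
      (herm k ((Pi.single m x : V ι) d) (X d)).im) =
      (∑ e, pd e (pd m f) (etas k X) * (herm k (v e) (X e)).im) * (herm k x (X m)).im := by
    rw [Finset.sum_eq_single m (fun d _ h => by simp [hz d _ h]) (by simp), Finset.sum_mul]
    exact Finset.sum_congr rfl fun e _ => by rw [Pi.single_eq_same]; ring
  have h3 : ∑ d, ∑ e, pd e (pd d f) (etas k X) * ((herm k ((Pi.single m x : V ι) e) (X e)).re *
      (herm k (v d) (X d)).re) =
      (∑ d, pd m (pd d f) (etas k X) * (herm k (v d) (X d)).re) * (herm k x (X m)).re := by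
    rw [Finset.sum_mul]
    refine Finset.sum_congr rfl fun d _ => ?_
    rw [Finset.sum_eq_single m (fun d _ h => by simp [hz d _ h]) (by simp), Pi.single_eq_same]
    ring
  simp only [metForm, mul_add, Finset.sum_add_distrib]
  rw [h1, h2, h3]
  ring

/-- The element of the orbit with components `!![0, a_d; 0, 0]`. -/
def basePoint (a : ι → ℝ) : V ι := fun d => mk 0 (a d : ℂ) 0

theorem exists_basePoint {k : ℝ} (hk : 0 < k) {t : ι → ℝ} (ht : t ∈ pos ι) :
    ∃ a : ι → ℝ, (∀ d, 0 < a d) ∧ (∀ d, 4 * k ^ 2 * a d ^ 2 = t d) ∧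
      basePoint a ∈ orbit ι ∧ etas k (basePoint a) = t := by
  have h : spin (baseSpinor k t) =
      basePoint fun d => Real.sqrt (Real.sqrt (t d) / (2 * k)) ^ 2 := by
    funext d
    apply ext_entries <;> simp [spin, spinOne, baseSpinor, basePoint]
  refine ⟨fun d => Real.sqrt (Real.sqrt (t d) / (2 * k)) ^ 2,
    fun d => pow_pos (baseSpinor_coord_pos hk ht d) 2, fun d => ?_, ?_, ?_⟩
  · dsimp only
    rw [Real.sq_sqrt (div_nonneg (Real.sqrt_nonneg _) (by positivity)), div_pow,
      Real.sq_sqrt (ht d).le]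
    field_simp
    ring
  · rw [← h]
    exact spin_mem_orbit (baseSpinor_mem hk ht)
  · rw [← h]
    exact etas_spin_baseSpinor hk ht

theorem br_single_basePoint (a : ι → ℝ) (j : ι) (x : Sl2) :
    br (Pi.single j x) (basePoint a) = Pi.single j ⁅x, basePoint a j⁆ := by
  funext d
  by_cases h : d = j
  · subst h; simp [br]
  · simp [br, Pi.single_eq_of_ne h]

theorem lie_mk_basePoint (a : ι → ℝ) (j : ι) (x : Sl2) :
    ⁅x, basePoint a j⁆ = mk (-(a j * x.1 1 0)) (2 * (a j * x.1 0 0)) 0 := by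
  apply ext_entries <;>
    simp only [lie_zero_zero, lie_zero_one, lie_one_zero, basePoint, mk_zero_zero, mk_zero_one,
      mk_one_zero] <;> ring

theorem herm_mk (k : ℝ) (a b c : ℂ) (x : Sl2) : herm k (mk a b c) x = 4 * (k : ℂ) ^ 2 *
    (2 * a * star (x.1 0 0) + b * star (x.1 0 1) + c * star (x.1 1 0)) := rfl

theorem ip_br_single_basePoint (k : ℝ) (a : ι → ℝ) (j : ι) (x : Sl2) (A : V ι) :
    ip k (br (Pi.single j x) A) (basePoint a) =
      -(8 * (k : ℂ) ^ 2 * a j * (x.1 1 0 * (A j).1 0 0 - (A j).1 1 0 * x.1 0 0)) := by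
  rw [ip_eq_sum, Finset.sum_eq_single j]
  · simp only [br, Pi.single_eq_same, basePoint, mk_zero_zero, mk_zero_one, mk_one_zero,
      lie_one_zero]
    ring
  · intro d _ h
    simp [br, Pi.single_eq_of_ne h]
  · simp

/-- The condition `J² = -1`, evaluated at the points `basePoint a`: the mixed second derivatives of
an invariant potential vanish, and in each variable it satisfies an ordinary differential
equation. -/
theorem potential_equations {k : ℝ} (hk : 0 < k) {H : HyperKahler ι} (hKKS : H.IsKKSCompatible k)
    {f : (ι → ℝ) → ℝ} (hf : ContDiffOn ℝ ∞ f (pos ι))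
    (hpot : H.IsKahlerPotential fun X => f (etas k X)) {t : ι → ℝ} (ht : t ∈ pos ι) (j : ι) :
    0 < pd j f t ∧ (∀ m, m ≠ j → pd m (pd j f) t = 0) ∧
      2 * t j * pd j f t * (pd j f t + t j * pd j (pd j f) t) = k ^ 2 := by
  obtain ⟨a, ha, hat, hX, hη⟩ := exists_basePoint hk ht
  set X := basePoint a with hXdef
  have hmet := fun v w : T X => metric_eq_metForm hk hKKS.1 hf hpot hX v w
  -- `ξ_F` for `F = !![0, 0; 1, 0]` in a single factor
  let φ : ι → T X := fun e => xi (Pi.single e (mk 0 0 1)) X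
  have hφ : ∀ e, (φ e : V ι) = Pi.single e (mk (-(a e : ℂ)) 0 0) := fun e => by
    change br (Pi.single e (mk 0 0 1)) X = _
    rw [hXdef, br_single_basePoint, lie_mk_basePoint]
    simp
  have hre : ∀ A B : V ι, H.g X (H.J X (xi A X)) (xi B X) = (ip k (br A B) X).re := fun A B => by
    rw [hKKS.2 X hX A B]
    simp
  have hgφ : ∀ (v : T X) (e : ι), H.g X v (φ e) =
      2 * (pd e f t * (herm k (mk (-(a e : ℂ)) 0 0) ((v : V ι) e)).re) := fun v e => by
    rw [hmet, hφ, metForm_single, hη]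
    simp [herm_mk, hXdef, basePoint]
  have hφφ : ∀ e i, H.g X (φ e) (φ i) = if e = i then 4 * pd i f t * t i else 0 := fun e i => by
    rw [hgφ, hφ]
    split_ifs with h
    · subst h
      rw [Pi.single_eq_same, herm_mk, ← hat]
      have : (4 * (k : ℂ) ^ 2 * (2 * -(a e : ℂ) * star ((mk (-(a e : ℂ)) 0 0).1 0 0) +
          0 * star ((mk (-(a e : ℂ)) 0 0).1 0 1) + 0 * star ((mk (-(a e : ℂ)) 0 0).1 1 0))) =
          ((8 * k ^ 2 * a e ^ 2 : ℝ) : ℂ) := by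
        simp
        ring
      rw [this, Complex.ofReal_re]
      ring
    · rw [Pi.single_eq_of_ne (Ne.symm h)]
      simp
  have hfpos : 0 < pd j f t := by
    have hne : φ j ≠ 0 := fun h => by
      have h1 := congrArg (fun v : T X => ((v : V ι) j).1 0 0) h
      simp only [hφ, Pi.single_eq_same, mk_zero_zero] at h1
      have h2 : (a j : ℂ) = 0 := neg_eq_zero.1 h1
      exact (ha j).ne' (by exact_mod_cast h2)
    have h1 := H.riemannian.pos X hX (φ j) hne
    rw [hφφ, if_pos rfl] at h1
    have h2 := ht j
    by_contra hcon
    have h3 : pd j f t * t j ≤ 0 := mul_nonpos_of_nonpos_of_nonneg (not_lt.1 hcon) h2.le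
    linarith
  obtain ⟨A, hA⟩ := exists_xi (H.J X (φ j))
  -- the real part of the coefficient of `ξ_h`, `h = !![1, 0; 0, -1]`, in `J ξ_F`
  have hα : ∀ e, -(8 * k ^ 2 * a e * ((A e).1 0 0).re) = if e = j then 4 * pd j f t * t j else 0 := by
    intro e
    rw [← hφφ e j, ← H.hermitian_J X hX (φ e) (φ j), hA]
    change _ = H.g X (H.J X (xi (Pi.single e (mk 0 0 1)) X)) (xi A X)
    rw [hre, hXdef, ip_br_single_basePoint]
    have h1 : -(8 * (k : ℂ) ^ 2 * a e * ((mk 0 0 1).1 1 0 * (A e).1 0 0 -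
        (A e).1 1 0 * (mk 0 0 1).1 0 0)) = ((-(8 * k ^ 2 * a e) : ℝ) : ℂ) * (A e).1 0 0 := by
      simp
    rw [h1, Complex.re_ofReal_mul]
    ring
  have hα0 : ∀ e, e ≠ j → ((A e).1 0 0).re = 0 := fun e he => by
    have h1 := hα e
    rw [if_neg he, neg_eq_zero] at h1
    have h2 : 8 * k ^ 2 * a e ≠ 0 := by have := ha e; positivity
    exact (mul_eq_zero.1 h1).resolve_left h2
  have hαj : ((A j).1 0 0).re = -(2 * pd j f t * a j) := by
    have h1 := hα j
    rw [if_pos rfl, ← hat] at h1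
    have h2 : 8 * k ^ 2 * a j ≠ 0 := by have := ha j; positivity
    apply mul_left_cancel₀ h2
    linear_combination -h1
  have hbrA : ∀ d, br A X d = mk (-(a d * (A d).1 1 0)) (2 * (a d * (A d).1 0 0)) 0 := fun d =>
    lie_mk_basePoint a d (A d)
  have hhat : ∀ d, (herm k (br A X d) (X d)).re = 2 * t d * ((A d).1 0 0).re := fun d => by
    have h1 : herm k (br A X d) (X d) = ((8 * k ^ 2 * a d ^ 2 : ℝ) : ℂ) * (A d).1 0 0 := by
      rw [hbrA, herm_mk]
      simp [hXdef, basePoint]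
      ring
    rw [h1, Complex.re_ofReal_mul, ← hat]
    ring
  -- the pairing of `J ξ_F` with `ξ_h` in the factor `m`
  have hm : ∀ m, 8 * t m * (pd m f t * ((A m).1 0 0).re +
      t j * pd m (pd j f) t * ((A j).1 0 0).re) = if m = j then -(8 * k ^ 2 * a j) else 0 := by
    intro m
    have e1 : H.g X (H.J X (φ j)) (xi (Pi.single m (mk 1 0 0)) X) =
        if m = j then -(8 * k ^ 2 * a j) else 0 := by
      rw [hre, hXdef, ip_br_single_basePoint]
      split_ifs with h
      · subst h
        have h1 : -(8 * (k : ℂ) ^ 2 * a m * ((mk 0 0 1).1 1 0 *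
            ((Pi.single m (mk 1 0 0) : V ι) m).1 0 0 -
            ((Pi.single m (mk 1 0 0) : V ι) m).1 1 0 * (mk 0 0 1).1 0 0)) =
            ((-(8 * k ^ 2 * a m) : ℝ) : ℂ) := by
          simp
        rw [h1, Complex.ofReal_re]
      · rw [Pi.single_eq_of_ne (Ne.symm h)]
        simp
    have hw : ((xi (Pi.single m (mk 1 0 0)) X : T X) : V ι) = Pi.single m (mk 0 (2 * a m) 0) := by
      change br (Pi.single m (mk 1 0 0)) X = _
      rw [hXdef, br_single_basePoint, lie_mk_basePoint]
      simp
    have h1 : (herm k (mk 0 (2 * a m) 0) (br A X m)).re = 4 * t m * ((A m).1 0 0).re := by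
      have h2 : herm k (mk 0 (2 * a m) 0) (br A X m) =
          ((16 * k ^ 2 * a m ^ 2 : ℝ) : ℂ) * star ((A m).1 0 0) := by
        rw [hbrA, herm_mk]
        simp
        ring
      rw [h2, Complex.re_ofReal_mul, ← hat, Complex.star_def, Complex.conj_re]
      ring
    have h2 : herm k (mk 0 (2 * a m) 0) (X m) = ((2 * t m : ℝ) : ℂ) := by
      rw [herm_mk, ← hat]
      simp [hXdef, basePoint]
      ring
    have h3 : ∑ d, pd m (pd d f) t * (herm k (br A X d) (X d)).re =
        pd m (pd j f) t * (2 * t j * ((A j).1 0 0).re) := by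
      rw [Finset.sum_eq_single j, hhat]
      · intro d _ hd
        rw [hhat, hα0 d hd]
        ring
      · simp
    rw [← e1, hA, hmet, hw, metForm_single, hη]
    change _ = 2 * (pd m f t * (herm k _ (br A X m)).re) + 2 * (∑ e, _ * (herm k (br A X e) _).im) * _
      + 2 * (∑ d, pd m (pd d f) t * (herm k (br A X d) (X d)).re) * _
    rw [h1, h2, h3, Complex.ofReal_im, Complex.ofReal_re]
    ring
  refine ⟨hfpos, fun m hmj => ?_, ?_⟩
  · have h1 := hm m
    rw [if_neg hmj, hα0 m hmj, hαj] at h1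
    have h2 : 16 * t m * t j * pd j f t * a j ≠ 0 := by
      have := ht m; have := ht j; have := ha j; positivity
    apply mul_left_cancel₀ h2
    linear_combination -h1
  · have h1 := hm j
    rw [if_pos rfl, hαj] at h1
    have h2 : 8 * a j ≠ 0 := by have := ha j; positivity
    apply mul_left_cancel₀ h2
    linear_combination -h1

end

section

/-! ### Separation of variables -/

variable {ι : Type} [Fintype ι] [DecidableEq ι]

/-- The function of one variable obtained from `f` by setting all variables except the one with
index `d` equal to `1`. -/
def oneVar (f : (ι → ℝ) → ℝ) (d : ι) (s : ℝ) : ℝ := f (Function.update 1 d s)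

theorem update_mem_pos (d : ι) {s : ℝ} (hs : 0 < s) : Function.update (1 : ι → ℝ) d s ∈ pos ι := by
  intro e
  by_cases h : e = d
  · subst h; simpa using hs
  · simp [Function.update_of_ne h]

theorem contDiffOn_oneVar {f : (ι → ℝ) → ℝ} (hf : ContDiffOn ℝ ∞ f (pos ι)) (d : ι) :
    ContDiffOn ℝ ∞ (oneVar f d) (Set.Ioi 0) :=
  hf.comp (contDiff_update ∞ 1 d).contDiffOn fun _ hs => update_mem_pos d hs

theorem hasDerivAt_oneVar {f : (ι → ℝ) → ℝ} (hf : ContDiffOn ℝ ∞ f (pos ι)) (d : ι) {s : ℝ}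
    (hs : 0 < s) : HasDerivAt (oneVar f d) (pd d f (Function.update 1 d s)) s :=
  (hasFDerivAt_of_contDiffOn_pos hf (update_mem_pos d hs)).comp_hasDerivAt s
    (hasDerivAt_update 1 d s)

/-- A function on `ℝ^ι` whose partial derivatives with index different from `d` vanish depends on
the variable with index `d` only. -/
theorem eq_of_pd_eq_zero {h : (ι → ℝ) → ℝ} (hh : ContDiffOn ℝ ∞ h (pos ι)) (d : ι)
    (hz : ∀ t ∈ pos ι, ∀ m, m ≠ d → pd m h t = 0) {t u : ι → ℝ} (ht : t ∈ pos ι) (hu : u ∈ pos ι)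
    (htu : t d = u d) : h t = h u := by
  have hseg : ∀ s ∈ Set.Icc (0 : ℝ) 1, t + s • (u - t) ∈ pos ι := fun s hs =>
    convex_pos.add_smul_sub_mem ht hu hs
  have hder : ∀ s ∈ Set.Icc (0 : ℝ) 1, HasDerivAt (fun s : ℝ => h (t + s • (u - t))) 0 s := by
    intro s hs
    have h1 : HasDerivAt (fun s : ℝ => t + s • (u - t)) (u - t) s := by
      simpa using ((hasDerivAt_id s).smul_const (u - t)).const_add t
    have h2 := (hasFDerivAt_of_contDiffOn_pos hh (hseg s hs)).comp_hasDerivAt s h1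
    refine h2.congr_deriv ?_
    rw [fderiv_eq_sum_pd]
    refine Finset.sum_eq_zero fun m _ => ?_
    by_cases hm : m = d
    · subst hm; simp [htu]
    · rw [hz _ (hseg s hs) m hm, zero_mul]
  have h1 := constant_of_has_deriv_right_zero (f := fun s : ℝ => h (t + s • (u - t)))
    (a := 0) (b := 1) (fun s hs => (hder s hs).continuousAt.continuousWithinAt)
    (fun s hs => (hder s ⟨hs.1, hs.2.le⟩).hasDerivWithinAt) 1 (by simp)
  simpa using h1.symm

section Sum

variable {F : ι → ℝ → ℝ} (hF : ∀ d, ContDiffOn ℝ ∞ (F d) (Set.Ioi 0))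

include hF

theorem contDiffOn_deriv_of_pos (d : ι) : ContDiffOn ℝ ∞ (deriv (F d)) (Set.Ioi 0) :=
  (hF d).deriv_of_isOpen isOpen_Ioi (by simp)

theorem hasDerivAt_of_pos (d : ι) {s : ℝ} (hs : 0 < s) : HasDerivAt (F d) (deriv (F d) s) s :=
  (((hF d).contDiffAt (Ioi_mem_nhds hs)).differentiableAt (by simp)).hasDerivAt

theorem contDiffOn_comp_eval (d : ι) : ContDiffOn ℝ ∞ (fun t : ι → ℝ => F d (t d)) (pos ι) :=
  (hF d).comp (contDiff_apply ℝ ℝ d).contDiffOn fun _ ht => ht d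

theorem contDiffOn_separated (C : ℝ) :
    ContDiffOn ℝ ∞ (fun t : ι → ℝ => ∑ d, F d (t d) + C) (pos ι) :=
  (ContDiffOn.sum fun d _ => contDiffOn_comp_eval hF d).add contDiffOn_const

theorem hasFDerivAt_comp_eval (d : ι) {t : ι → ℝ} (ht : t ∈ pos ι) :
    HasFDerivAt (fun t : ι → ℝ => F d (t d))
      (deriv (F d) (t d) • (ContinuousLinearMap.proj d : (ι → ℝ) →L[ℝ] ℝ)) t :=
  (hasDerivAt_of_pos hF d (ht d)).comp_hasFDerivAt t
    (ContinuousLinearMap.proj d : (ι → ℝ) →L[ℝ] ℝ).hasFDerivAt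

theorem pd_comp_eval (d e : ι) {t : ι → ℝ} (ht : t ∈ pos ι) :
    pd e (fun t : ι → ℝ => F d (t d)) t = if e = d then deriv (F d) (t d) else 0 := by
  rw [pd, (hasFDerivAt_comp_eval hF d ht).fderiv]
  simp [Pi.single_apply, eq_comm]

theorem pd_separated (C : ℝ) (e : ι) {t : ι → ℝ} (ht : t ∈ pos ι) :
    pd e (fun t : ι → ℝ => ∑ d, F d (t d) + C) t = deriv (F e) (t e) := by
  have h := (HasFDerivAt.fun_sum fun d (_ : d ∈ Finset.univ) =>
    hasFDerivAt_comp_eval hF d ht).add_const C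
  rw [pd, h.fderiv]
  simp [Pi.single_apply]

end Sum

theorem pd_congr {f f' : (ι → ℝ) → ℝ} (h : Set.EqOn f f' (pos ι)) (d : ι) {t : ι → ℝ}
    (ht : t ∈ pos ι) : pd d f t = pd d f' t := by
  have h1 : f =ᶠ[nhds t] f' := by
    filter_upwards [isOpen_pos.mem_nhds ht] with u hu using h hu
  rw [pd, pd, h1.fderiv_eq]

theorem eq_add_const_of_pd_eq {f f' : (ι → ℝ) → ℝ} (hf : ContDiffOn ℝ ∞ f (pos ι))
    (hf' : ContDiffOn ℝ ∞ f' (pos ι)) (h : ∀ t ∈ pos ι, ∀ d, pd d f t = pd d f' t) :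
    ∃ C, ∀ t ∈ pos ι, f t = f' t + C := by
  have hd : ∀ t ∈ pos ι, HasFDerivAt (fun u => f u - f' u) (0 : (ι → ℝ) →L[ℝ] ℝ) t := by
    intro t ht
    refine ((hasFDerivAt_of_contDiffOn_pos hf ht).sub
      (hasFDerivAt_of_contDiffOn_pos hf' ht)).congr_fderiv ?_
    ext u
    simp [fderiv_eq_sum_pd, h t ht]
  have h1 : (1 : ι → ℝ) ∈ pos ι := fun _ => one_pos
  refine ⟨f 1 - f' 1, fun t ht => ?_⟩
  have h2 := isOpen_pos.is_const_of_fderiv_eq_zero convex_pos.isPreconnected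
    (fun t ht => (hd t ht).differentiableAt.differentiableWithinAt)
    (fun t ht => (hd t ht).fderiv) ht h1
  linarith

/-- A function of several variables with vanishing mixed second derivatives is a sum of functions
of one variable. -/
theorem eq_sum_oneVar {f : (ι → ℝ) → ℝ} (hf : ContDiffOn ℝ ∞ f (pos ι))
    (hz : ∀ t ∈ pos ι, ∀ d m, m ≠ d → pd m (pd d f) t = 0) :
    ∃ C, ∀ t ∈ pos ι, f t = ∑ d, oneVar f d (t d) + C := by
  have hF := contDiffOn_oneVar hf
  obtain ⟨C, hC⟩ := eq_add_const_of_pd_eq hf (contDiffOn_separated hF 0) fun t ht d => by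
    rw [pd_separated hF 0 d ht, (hasDerivAt_oneVar hf d (ht d)).deriv]
    exact eq_of_pd_eq_zero (contDiffOn_pd hf d) d (fun t ht m hm => hz t ht d m hm) ht
      (update_mem_pos d (ht d)) (by simp)
  exact ⟨C, fun t ht => by rw [hC t ht, add_zero]⟩

/-! ### The metric of a sum of functions of one variable -/

/-- The metric with Kähler potential `F(η)` on a single factor. -/
def oneMet (k : ℝ) (F : ℝ → ℝ) (x v w : Sl2) : ℝ :=
  2 * deriv F (etaOne k x) * (herm k w v).re + 2 * deriv (deriv F) (etaOne k x) *
    ((herm k v x).im * (herm k w x).im + (herm k w x).re * (herm k v x).re)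

theorem metForm_separated {k : ℝ} (hk : 0 < k) {F : ι → ℝ → ℝ}
    (hF : ∀ d, ContDiffOn ℝ ∞ (F d) (Set.Ioi 0)) {f : (ι → ℝ) → ℝ} (C : ℝ)
    (hf : ∀ t ∈ pos ι, f t = ∑ d, F d (t d) + C) {X : V ι} (hX : X ∈ orbit ι) (v w : V ι) :
    metForm k f X v w = ∑ d, oneMet k (F d) (X d) (v d) (w d) := by
  have hη := etas_mem_pos hk hX
  have h1 : ∀ d, ∀ t ∈ pos ι, pd d f t = deriv (F d) (t d) := fun d t ht => by
    rw [pd_congr hf d ht, pd_separated hF C d ht]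
  have h2 : ∀ d e, pd e (pd d f) (etas k X) =
      if e = d then deriv (deriv (F d)) (etas k X d) else 0 := fun d e => by
    rw [pd_congr (h1 d) e hη]
    exact pd_comp_eval (contDiffOn_deriv_of_pos hF) d e hη
  rw [metForm, Finset.mul_sum, Finset.mul_sum, ← Finset.sum_add_distrib]
  refine Finset.sum_congr rfl fun d _ => ?_
  rw [Finset.sum_eq_single d (fun e _ he => by rw [h2, if_neg he, zero_mul]) (by simp), h2,
    if_pos rfl, h1 d _ hη, oneMet]
  simp only [etas]
  ring

/-- The differential equation for `F`, integrated once. -/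
theorem exists_integration_constant {k : ℝ} (hk : 0 < k) {F : ℝ → ℝ}
    (hF : ContDiffOn ℝ ∞ F (Set.Ioi 0)) (hode : ∀ s, 0 < s →
      2 * s * deriv F s * (deriv F s + s * deriv (deriv F) s) = k ^ 2) :
    ∃ c, 0 ≤ c ∧ ∀ s, 0 < s → (s * deriv F s) ^ 2 = k ^ 2 * s + c / 4 := by
  have hF' : ContDiffOn ℝ ∞ (deriv F) (Set.Ioi 0) := hF.deriv_of_isOpen isOpen_Ioi (by simp)
  have hd : ∀ s ∈ Set.Ioi (0 : ℝ),
      HasDerivAt (fun s => (s * deriv F s) ^ 2 - k ^ 2 * s) 0 s := fun s hs => by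
    have h1 : HasDerivAt (deriv F) (deriv (deriv F) s) s :=
      ((hF'.contDiffAt (Ioi_mem_nhds hs)).differentiableAt (by simp)).hasDerivAt
    have h2 := (((hasDerivAt_id s).mul h1).pow 2).sub ((hasDerivAt_id s).const_mul (k ^ 2))
    refine h2.congr_deriv ?_
    simp only [id, Pi.mul_apply]
    push_cast
    linear_combination hode s hs
  have hc : ∀ s, 0 < s → (s * deriv F s) ^ 2 = k ^ 2 * s + (deriv F 1 ^ 2 - k ^ 2) := by
    intro s hs
    have h2 := isOpen_Ioi.is_const_of_deriv_eq_zero isPreconnected_Ioi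
      (fun t ht => (hd t ht).differentiableAt.differentiableWithinAt)
      (fun t ht => (hd t ht).deriv) (Set.mem_Ioi.2 hs) (Set.mem_Ioi.2 one_pos)
    linarith
  refine ⟨4 * (deriv F 1 ^ 2 - k ^ 2), ?_, fun s hs => by rw [hc s hs]; ring⟩
  -- the left side is a square, and the right side tends to the constant as `s → 0`
  by_contra hneg
  set b := deriv F 1 ^ 2 - k ^ 2
  have hb : b < 0 := by linarith
  have hs : 0 < -b / (2 * k ^ 2) := div_pos (by linarith) (by positivity)
  have h1 := hc _ hs
  have h2 : k ^ 2 * (-b / (2 * k ^ 2)) = -b / 2 := by field_simp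
  rw [h2] at h1
  have h3 := sq_nonneg (-b / (2 * k ^ 2) * deriv F (-b / (2 * k ^ 2)))
  linarith

theorem oneMet_eq_explicitMetric {k : ℝ} {F : ℝ → ℝ} {c : ℝ} (X v w : V Unit)
    (hη : 0 < eta k X) (hpos : 0 < deriv F (eta k X))
    (hsq : (eta k X * deriv F (eta k X)) ^ 2 = k ^ 2 * eta k X + c / 4)
    (hode : 2 * eta k X * deriv F (eta k X) *
      (deriv F (eta k X) + eta k X * deriv (deriv F) (eta k X)) = k ^ 2) :
    oneMet k F (X ()) (v ()) (w ()) = explicitMetric k c X v w := by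
  have hs : Real.sqrt (4 * k ^ 2 * eta k X + c) = 2 * (eta k X * deriv F (eta k X)) := by
    rw [show 4 * k ^ 2 * eta k X + c = (2 * (eta k X * deriv F (eta k X))) ^ 2 by
      linear_combination -4 * hsq]
    exact Real.sqrt_sq (by positivity)
  have hq : (2 * k ^ 2 * eta k X + c) / (4 * k ^ 2 * eta k X + c) =
      -(eta k X * deriv (deriv F) (eta k X)) / deriv F (eta k X) := by
    have h1 : 4 * k ^ 2 * eta k X + c = 4 * (eta k X * deriv F (eta k X)) ^ 2 := by
      linear_combination -4 * hsq
    have h2 : 2 * k ^ 2 * eta k X + c =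
        4 * (eta k X * deriv F (eta k X)) ^ 2 - 2 * eta k X * (2 * eta k X * deriv F (eta k X) *
          (deriv F (eta k X) + eta k X * deriv (deriv F) (eta k X))) := by
      rw [hode]
      linear_combination -4 * hsq
    rw [h1, h2]
    field_simp
    ring
  have hip : ∀ a b : V Unit, ip k a (sig b) = herm k (a ()) (b ()) := fun a b => by
    rw [ip_sig]
    simp
  rw [explicitMetric, hs, hq, ip_comm k (sig w) X, hip, hip, hip, oneMet, ← eta_unit,
    ← herm_star k (w ()) (X ()), herm_re_comm k (w ()) (v ())]
  rw [Complex.sub_re, Complex.re_ofReal_mul, Complex.re_ofReal_mul, Complex.mul_re, Complex.star_def,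
    Complex.conj_re, Complex.conj_im]
  field_simp
  ring

end

section

/-! ### Restriction to a factor of the orbit -/

variable {ι : Type} [Fintype ι] [DecidableEq ι]

/-- The embedding of the orbit of a single factor in the orbit of all factors, with the remaining
components equal to `nilE`. -/
def extPt (d : ι) (X : V Unit) : V ι := Function.update (fun _ => nilE) d (X ())

/-- The inclusion of `sl(2,ℂ)` in `sl(2,ℂ)^ι` as the factor with index `d`. -/
def extVec (d : ι) (A : V Unit) : V ι := Pi.single d (A ())

/-- The inclusion of `SL(2,ℂ)` in `SL(2,ℂ)^ι` as the factor with index `d`. -/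
def extGrp (d : ι) (U : Unit → Matrix.SpecialLinearGroup (Fin 2) ℂ) :
    ι → Matrix.SpecialLinearGroup (Fin 2) ℂ := Function.update 1 d (U ())

@[simp] theorem extPt_same (d : ι) (X : V Unit) : extPt d X d = X () := Function.update_self ..

@[simp] theorem extVec_same (d : ι) (A : V Unit) : extVec d A d = A () := Pi.single_eq_same ..

theorem extVec_of_ne {d e : ι} (h : e ≠ d) (A : V Unit) : extVec d A e = 0 :=
  Pi.single_eq_of_ne h _

theorem adj_one (x : Sl2) : adj 1 x = x := by
  apply Subtype.ext
  simp [adj]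

theorem adj_zero (u : Matrix.SpecialLinearGroup (Fin 2) ℂ) : adj u 0 = 0 := by
  apply Subtype.ext
  simp [adj]

theorem extPt_Ad (d : ι) (U : Unit → Matrix.SpecialLinearGroup (Fin 2) ℂ) (X : V Unit) :
    extPt d (Ad U X) = Ad (extGrp d U) (extPt d X) := by
  funext e
  by_cases h : e = d
  · subst h; simp [extPt, extGrp, Ad]
  · simp [extPt, extGrp, Ad, Function.update_of_ne h, adj_one]

theorem extVec_Ad (d : ι) (U : Unit → Matrix.SpecialLinearGroup (Fin 2) ℂ) (A : V Unit) :
    extVec d (Ad U A) = Ad (extGrp d U) (extVec d A) := by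
  funext e
  by_cases h : e = d
  · subst h; simp [extVec, extGrp, Ad]
  · simp [extVec, extGrp, Ad, Pi.single_eq_of_ne h, adj_zero]

theorem extVec_br (d : ι) (A X : V Unit) : extVec d (br A X) = br (extVec d A) (extPt d X) := by
  funext e
  by_cases h : e = d
  · subst h; simp [extVec, extPt, br]
  · simp [extVec, br, Pi.single_eq_of_ne h]

theorem extVec_br_extVec (d : ι) (A B : V Unit) :
    extVec d (br A B) = br (extVec d A) (extVec d B) := by
  funext e
  by_cases h : e = d
  · subst h; simp [extVec, br]
  · simp [extVec, br, Pi.single_eq_of_ne h]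

theorem inSU2_extGrp (d : ι) {U : Unit → Matrix.SpecialLinearGroup (Fin 2) ℂ} (hU : InSU2 U) :
    InSU2 (extGrp d U) := by
  intro e
  by_cases h : e = d
  · subst h
    simpa [extGrp] using hU ()
  · rw [extGrp, Function.update_of_ne h]
    exact (Matrix.specialUnitaryGroup (Fin 2) ℂ).one_mem

theorem extPt_mem (d : ι) {X : V Unit} (hX : X ∈ orbit Unit) : extPt d X ∈ orbit ι := by
  obtain ⟨U, rfl⟩ := hX
  refine ⟨extGrp d U, ?_⟩
  rw [extPt_Ad]
  congr 1
  exact Function.update_eq_self d fun _ => nilE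

theorem comp_mem (d : ι) {X : V ι} (hX : X ∈ orbit ι) : comp d X ∈ orbit Unit := by
  obtain ⟨U, rfl⟩ := hX
  exact ⟨fun _ => U d, rfl⟩

theorem extVec_add (d : ι) (A B : V Unit) : extVec d (A + B) = extVec d A + extVec d B :=
  Pi.single_add (f := fun _ : ι => Sl2) d (A ()) (B ())

theorem extVec_smul (d : ι) (c : ℝ) (A : V Unit) : extVec d (c • A) = c • extVec d A :=
  Pi.single_smul (f := fun _ : ι => Sl2) d c (A ())

/-- `extVec` as a continuous real linear map. -/
def extVecL (d : ι) : V Unit →L[ℝ] V ι :=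
  LinearMap.toContinuousLinearMap
    { toFun := extVec d
      map_add' := extVec_add d
      map_smul' := extVec_smul d }

/-- `comp` as a continuous real linear map. -/
def compL (d : ι) : V ι →L[ℝ] V Unit :=
  LinearMap.toContinuousLinearMap ((comp d).restrictScalars ℝ)

theorem extPt_eq (d : ι) (X : V Unit) : extPt d X = extVec d X + extPt d 0 := by
  funext e
  by_cases h : e = d
  · subst h; simp
  · rw [Pi.add_apply, extVec_of_ne h, zero_add, extPt, extPt, Function.update_of_ne h,
      Function.update_of_ne h]

theorem hasFDerivAt_extPt (d : ι) (X : V Unit) : HasFDerivAt (extPt d) (extVecL d) X := by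
  rw [funext (extPt_eq d)]
  exact (extVecL d).hasFDerivAt.add_const (extPt d 0)

theorem contDiff_extPt (d : ι) {n : WithTop ℕ∞} : ContDiff ℝ n (extPt d : V Unit → V ι) := by
  rw [funext (extPt_eq d)]
  exact (extVecL d).contDiff.add contDiff_const

theorem SmoothFn.comp_extPt {φ : V ι → ℝ} (hφ : SmoothFn φ) (d : ι) :
    SmoothFn fun X => φ (extPt d X) :=
  ContDiffOn.comp hφ (contDiff_extPt d).contDiffOn fun _ hX => extPt_mem d hX

theorem lieD_comp_extPt {φ : V ι → ℝ} (hφ : SmoothFn φ) (d : ι) (A : V Unit) {X : V Unit}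
    (hX : X ∈ orbit Unit) :
    lieD A (fun Y => φ (extPt d Y)) X = lieD (extVec d A) φ (extPt d X) := by
  have h1 := (hφ.differentiableWithinAt (extPt_mem d hX)).hasFDerivWithinAt
  have h2 : HasFDerivWithinAt (fun Y => φ (extPt d Y)) _ (orbit Unit) X :=
    h1.comp X (hasFDerivAt_extPt d X).hasFDerivWithinAt fun _ hY => extPt_mem d hY
  rw [lieD_eq_of_hasFDerivWithinAt hX h2, lieD_eq_of_hasFDerivWithinAt (extPt_mem d hX) h1,
    ← extVec_br]
  rfl

/-- The inclusion of the tangent space of a factor. -/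
def extT (d : ι) (X : V Unit) : T X →ₗ[ℝ] T (extPt d X) where
  toFun v := ⟨extVec d v, by
    obtain ⟨_, A, rfl⟩ := v
    exact ⟨extVec d A, (extVec_br d A X).symm⟩⟩
  map_add' v w := Subtype.ext (extVec_add d _ _)
  map_smul' c v := Subtype.ext (extVec_smul d c _)

/-- The projection onto the tangent space of a factor, at a point of the embedded factor. -/
def projT (d : ι) (X : V Unit) : T (extPt d X) →ₗ[ℝ] T X where
  toFun v := ⟨fun _ => (v : V ι) d, by
    obtain ⟨_, A, rfl⟩ := v
    refine ⟨fun _ => A d, funext fun _ => ?_⟩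
    change ⁅A d, X ()⁆ = ⁅A d, extPt d X d⁆
    rw [extPt_same]⟩
  map_add' v w := rfl
  map_smul' c v := rfl

theorem extT_xi (d : ι) (A X : V Unit) : extT d X (xi A X) = xi (extVec d A) (extPt d X) :=
  Subtype.ext (extVec_br d A X)

theorem extT_same (d : ι) {X : V Unit} (v : T X) : (extT d X v : V ι) d = (v : V Unit) () :=
  extVec_same d _

theorem extT_of_ne {d e : ι} (h : e ≠ d) {X : V Unit} (v : T X) : (extT d X v : V ι) e = 0 :=
  extVec_of_ne h _

theorem projT_extT (d : ι) (X : V Unit) (v : T X) : projT d X (extT d X v) = v :=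
  Subtype.ext (funext fun _ => extT_same d v)

theorem extT_injective (d : ι) (X : V Unit) : Function.Injective (extT d X) :=
  Function.LeftInverse.injective (projT_extT d X)

/-- An endomorphism field is split if the component of its value with index `d` depends only on the
components with index `d` of the point and of the tangent vector. -/
def IsSplitEnd (E : EndField ι) : Prop :=
  ∀ d, ∀ X ∈ orbit ι, ∀ X' ∈ orbit ι, X d = X' d → ∀ (v : T X) (v' : T X'),
    (v : V ι) d = (v' : V ι) d → (E X v : V ι) d = (E X' v' : V ι) d

/-- The metric `g` is the orthogonal sum of the forms `m d` on the factors. -/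
structure IsSplitMetric (g : Tensor2 ι) (m : ι → Sl2 → Sl2 → Sl2 → ℝ) : Prop where
  eq_sum : ∀ X ∈ orbit ι, ∀ v w : T X, g X v w = ∑ d, m d (X d) ((v : V ι) d) ((w : V ι) d)
  zero_left : ∀ d x w, m d x 0 w = 0
  zero_right : ∀ d x v, m d x v 0 = 0

/-- The endomorphism field induced on a factor. -/
def resEnd (E : EndField ι) (d : ι) : EndField Unit := fun X =>
  projT d X ∘ₗ E (extPt d X) ∘ₗ extT d X

/-- The tensor induced on a factor. -/
def resMet (g : Tensor2 ι) (d : ι) : Tensor2 Unit := fun X =>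
  (g (extPt d X)).compl₁₂ (extT d X) (extT d X)

theorem IsSplitEnd.extT_resEnd {E : EndField ι} (hE : IsSplitEnd E) (d : ι) {X : V Unit}
    (hX : X ∈ orbit Unit) (v : T X) : extT d X (resEnd E d X v) = E (extPt d X) (extT d X v) := by
  apply Subtype.ext
  funext e
  by_cases h : e = d
  · subst h
    exact extT_same e _
  · rw [extT_of_ne h, hE e _ (extPt_mem d hX) _ (extPt_mem d hX) rfl (extT d X v) 0
      (extT_of_ne h v), map_zero]
    rfl

theorem IsSplitMetric.apply_extT_right {g : Tensor2 ι} {m : ι → Sl2 → Sl2 → Sl2 → ℝ}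
    (hm : IsSplitMetric g m) (d : ι) {X : V Unit} (hX : X ∈ orbit Unit) (v : T (extPt d X))
    (w : T X) : g (extPt d X) v (extT d X w) = m d (X ()) ((v : V ι) d) ((w : V Unit) ()) := by
  rw [hm.eq_sum _ (extPt_mem d hX), Finset.sum_eq_single d, extT_same, extPt_same]
  · intro e _ he
    rw [extT_of_ne he, hm.zero_right]
  · simp

theorem IsSplitMetric.apply_extT_left {g : Tensor2 ι} {m : ι → Sl2 → Sl2 → Sl2 → ℝ}
    (hm : IsSplitMetric g m) (d : ι) {X : V Unit} (hX : X ∈ orbit Unit) (v : T X)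
    (w : T (extPt d X)) :
    g (extPt d X) (extT d X v) w = m d (X ()) ((v : V Unit) ()) ((w : V ι) d) := by
  rw [hm.eq_sum _ (extPt_mem d hX), Finset.sum_eq_single d, extT_same, extPt_same]
  · intro e _ he
    rw [extT_of_ne he, hm.zero_left]
  · simp

theorem IsSplitMetric.resMet_eq {g : Tensor2 ι} {m : ι → Sl2 → Sl2 → Sl2 → ℝ}
    (hm : IsSplitMetric g m) (d : ι) {X : V Unit} (hX : X ∈ orbit Unit) (v w : T X) :
    resMet g d X v w = m d (X ()) ((v : V Unit) ()) ((w : V Unit) ()) := by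
  rw [← extT_same d v]
  exact hm.apply_extT_right d hX _ w

theorem smoothEnd_resEnd {E : EndField ι} (hE : SmoothEnd E) (d : ι) : SmoothEnd (resEnd E d) := by
  intro A
  have h1 : ContDiffOn ℝ ∞ (fun X : V Unit =>
      compL d (E (extPt d X) (xi (extVec d A) (extPt d X)) : V ι)) (orbit Unit) :=
    (compL d).contDiff.comp_contDiffOn
      ((hE (extVec d A)).comp (contDiff_extPt d).contDiffOn fun _ hX => extPt_mem d hX)
  refine h1.congr fun X _ => ?_
  rw [← extT_xi]
  rfl

theorem isHermitian_res {g : Tensor2 ι} {E : EndField ι} (hE : IsSplitEnd E)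
    (h : IsHermitian g E) (d : ι) : IsHermitian (resMet g d) (resEnd E d) := by
  intro X hX v w
  change g _ (extT d X _) (extT d X _) = _
  rw [hE.extT_resEnd d hX, hE.extT_resEnd d hX]
  exact h _ (extPt_mem d hX) _ _

theorem isRiemannian_res {g : Tensor2 ι} (hg : IsRiemannian g) (d : ι) :
    IsRiemannian (resMet g d) where
  smooth A B := by
    refine ((hg.smooth (extVec d A) (extVec d B)).comp_extPt d).congr fun X _ => ?_
    dsimp only
    rw [← extT_xi, ← extT_xi]
    rfl
  symm X hX v w := hg.symm _ (extPt_mem d hX) _ _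
  pos X hX v hv := hg.pos _ (extPt_mem d hX) _ fun h =>
    hv (extT_injective d X (h.trans (map_zero _).symm))

/-- The Levi-Civita connection of a factor is induced from the one of the product. -/
def resConn (D : V ι → V ι → (X : V ι) → T X) (d : ι) (A B X : V Unit) : T X :=
  projT d X (D (extVec d A) (extVec d B) (extPt d X))

theorem isLeviCivita_res {g : Tensor2 ι} {m : ι → Sl2 → Sl2 → Sl2 → ℝ} (hm : IsSplitMetric g m)
    (hg : IsRiemannian g) {D : V ι → V ι → (X : V ι) → T X} (hD : IsLeviCivita g D) (d : ι) :
    IsLeviCivita (resMet g d) (resConn D d) where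
  torsion_free X hX A B := by
    rw [resConn, resConn, ← map_sub, hD.torsion_free _ (extPt_mem d hX), ← extVec_br_extVec,
      ← extT_xi, ← map_neg, projT_extT]
  metric X hX A B C := by
    have h := hD.metric _ (extPt_mem d hX) (extVec d A) (extVec d B) (extVec d C)
    change lieD (extVec d A) _ (extPt d X) = _ at h
    rw [← lieD_comp_extPt (hg.smooth _ _) d A hX] at h
    change lieD A _ X = _
    simp only [← extT_xi] at h
    rw [hm.apply_extT_right d hX, hm.apply_extT_left d hX] at h
    rw [hm.resMet_eq d hX, hm.resMet_eq d hX]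
    exact h

theorem isParallel_res {g : Tensor2 ι} {m : ι → Sl2 → Sl2 → Sl2 → ℝ} (hm : IsSplitMetric g m)
    {D : V ι → V ι → (X : V ι) → T X} {E : EndField ι} (hE : IsSplitEnd E)
    (hs : ∀ A B, SmoothFn fun X => g X (E X (xi A X)) (xi B X)) (hD : IsParallel g D E) (d : ι) :
    IsParallel (resMet g d) (resConn D d) (resEnd E d) := by
  intro X hX A B C
  have h := hD _ (extPt_mem d hX) (extVec d A) (extVec d B) (extVec d C)
  change lieD (extVec d A) _ (extPt d X) = _ at h
  rw [← lieD_comp_extPt (hs _ _) d A hX] at h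
  change lieD A _ X = _
  simp only [← extT_xi] at h
  have h1 : ∀ Y ∈ orbit Unit, resMet g d Y (resEnd E d Y (xi B Y)) (xi C Y) =
      g (extPt d Y) (E (extPt d Y) (extT d Y (xi B Y))) (extT d Y (xi C Y)) := fun Y hY => by
    rw [← hE.extT_resEnd d hY]
    rfl
  rw [lieD_congr h1 hX, h, ← hE.extT_resEnd d hX (xi B X), hm.apply_extT_right d hX,
    hm.apply_extT_left d hX, hm.resMet_eq d hX, hm.resMet_eq d hX]
  congr 2
  refine hE d _ (extPt_mem d hX) _ (extPt_mem d hX) rfl _ _ ?_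
  rw [extT_same]
  rfl

/-- The hyperKähler structure induced on a factor by a split hyperKähler structure. -/
def HyperKahler.restrict (H : HyperKahler ι) {m : ι → Sl2 → Sl2 → Sl2 → ℝ}
    (hm : IsSplitMetric H.g m) (hI : IsSplitEnd H.I) (hJ : IsSplitEnd H.J) (hK : IsSplitEnd H.K)
    (hsI : ∀ A B, SmoothFn fun X => H.g X (H.I X (xi A X)) (xi B X))
    (hsJ : ∀ A B, SmoothFn fun X => H.g X (H.J X (xi A X)) (xi B X))
    (hsK : ∀ A B, SmoothFn fun X => H.g X (H.K X (xi A X)) (xi B X)) (d : ι) :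
    HyperKahler Unit where
  g := resMet H.g d
  I := resEnd H.I d
  J := resEnd H.J d
  K := resEnd H.K d
  riemannian := isRiemannian_res H.riemannian d
  smooth_I := smoothEnd_resEnd H.smooth_I d
  smooth_J := smoothEnd_resEnd H.smooth_J d
  smooth_K := smoothEnd_resEnd H.smooth_K d
  I_sq X hX v := extT_injective d X <| by
    rw [hI.extT_resEnd d hX, hI.extT_resEnd d hX, H.I_sq _ (extPt_mem d hX), map_neg]
  J_sq X hX v := extT_injective d X <| by
    rw [hJ.extT_resEnd d hX, hJ.extT_resEnd d hX, H.J_sq _ (extPt_mem d hX), map_neg]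
  I_J X hX v := extT_injective d X <| by
    rw [hI.extT_resEnd d hX, hJ.extT_resEnd d hX, H.I_J _ (extPt_mem d hX), hK.extT_resEnd d hX]
  J_I X hX v := extT_injective d X <| by
    rw [hJ.extT_resEnd d hX, hI.extT_resEnd d hX, H.J_I _ (extPt_mem d hX), map_neg,
      hK.extT_resEnd d hX]
  hermitian_I := isHermitian_res hI H.hermitian_I d
  hermitian_J := isHermitian_res hJ H.hermitian_J d
  hermitian_K := isHermitian_res hK H.hermitian_K d
  parallel := by
    obtain ⟨D, hD, hDI, hDJ, hDK⟩ := H.parallel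
    exact ⟨resConn D d, isLeviCivita_res hm H.riemannian hD d, isParallel_res hm hI hsI hDI d,
      isParallel_res hm hJ hsJ hDJ d, isParallel_res hm hK hsK hDK d⟩

theorem invariantEnd_res {E : EndField ι} (hE : InvariantEnd E) (d : ι) :
    InvariantEnd (resEnd E d) := by
  intro U hU X hX A
  have h := hE (extGrp d U) (inSU2_extGrp d hU) _ (extPt_mem d hX) (extVec d A)
  rw [← extPt_Ad, ← extVec_Ad, ← extT_xi, ← extT_xi] at h
  funext i
  refine (congrFun h d).trans ?_
  change adj (extGrp d U d) _ = adj (U ()) _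
  rw [extGrp, Function.update_self]
  rfl

section Restrict

variable {H : HyperKahler ι} {m : ι → Sl2 → Sl2 → Sl2 → ℝ} (hm : IsSplitMetric H.g m)
  (hI : IsSplitEnd H.I) (hJ : IsSplitEnd H.J) (hK : IsSplitEnd H.K)
  (hsI : ∀ A B, SmoothFn fun X => H.g X (H.I X (xi A X)) (xi B X))
  (hsJ : ∀ A B, SmoothFn fun X => H.g X (H.J X (xi A X)) (xi B X))
  (hsK : ∀ A B, SmoothFn fun X => H.g X (H.K X (xi A X)) (xi B X))

theorem isInvariant_restrict (hinv : H.IsInvariant) (d : ι) :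
    (H.restrict hm hI hJ hK hsI hsJ hsK d).IsInvariant := by
  refine ⟨fun U hU X hX A B => ?_, invariantEnd_res hinv.2.1 d, invariantEnd_res hinv.2.2.1 d,
    invariantEnd_res hinv.2.2.2 d⟩
  have h := hinv.1 (extGrp d U) (inSU2_extGrp d hU) _ (extPt_mem d hX) (extVec d A) (extVec d B)
  rw [← extPt_Ad, ← extVec_Ad, ← extVec_Ad] at h
  simp only [← extT_xi] at h
  exact h

theorem ip_br_ext (k : ℝ) (d : ι) (A B X : V Unit) :
    ip k (br (extVec d A) (extVec d B)) (extPt d X) = ip k (br A B) X := by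
  rw [← extVec_br_extVec, ip_eq_sum, ip_eq_sum, Finset.sum_eq_single d]
  · simp
  · intro e _ he
    simp [extVec_of_ne he]
  · simp

theorem isKKSCompatible_restrict {k : ℝ} (hKKS : H.IsKKSCompatible k) (d : ι) :
    (H.restrict hm hI hJ hK hsI hsJ hsK d).IsKKSCompatible k := by
  refine ⟨fun X hX => LinearMap.ext fun v => extT_injective d X ?_, fun X hX A B => ?_⟩
  · refine (hI.extT_resEnd d hX v).trans ?_
    rw [hKKS.1 _ (extPt_mem d hX)]
    exact Subtype.ext (Pi.single_smul d Complex.I _).symm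
  · have h := hKKS.2 _ (extPt_mem d hX) (extVec d A) (extVec d B)
    rw [ip_br_ext, ← extT_xi, ← extT_xi, ← hJ.extT_resEnd d hX, ← hK.extT_resEnd d hX] at h
    exact h

theorem isProduct_restrict : H.IsProduct (H.restrict hm hI hJ hK hsI hsJ hsK) := by
  have hE : ∀ {E : EndField ι}, IsSplitEnd E → ∀ X ∈ orbit ι, ∀ (d : ι) (v : T X),
      compT d X (E X v) = resEnd E d (comp d X) (compT d X v) := by
    intro E hE X hX d v
    apply Subtype.ext
    funext i
    refine hE d X hX _ (extPt_mem d (comp_mem d hX)) (extPt_same d (comp d X)).symm v _ ?_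
    rw [extT_same]
    rfl
  refine fun X hX => ⟨fun v w => ?_, fun d v => ⟨hE hI X hX d v, hE hJ X hX d v, hE hK X hX d v⟩⟩
  rw [hm.eq_sum X hX]
  exact Finset.sum_congr rfl fun d _ => (hm.resMet_eq d (comp_mem d hX) (compT d X v) (compT d X w)).symm

end Restrict

/-! ### Compatible structures with a sum of metrics are split -/

theorem ip_br_eq (k : ℝ) (A B X : V ι) : ip k (br A B) X = -ip k B (br A X) := by
  rw [ip_eq_sum, ip_eq_sum, ← Finset.sum_neg_distrib]
  refine Finset.sum_congr rfl fun d _ => ?_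
  simp only [br, lie_zero_zero, lie_zero_one, lie_one_zero]
  ring

theorem xi_single {d : ι} (b : Sl2) (X : V ι) :
    ((xi (Pi.single d b) X : T X) : V ι) = Pi.single d ⁅b, X d⁆ := by
  funext e
  change ⁅(Pi.single d b : V ι) e, X e⁆ = _
  by_cases h : e = d
  · subst h; simp
  · simp [Pi.single_eq_of_ne h]

/-- An endomorphism field `E` for which `g(E·, ·)` is the real part of a complex multiple of the
Kirillov-Kostant-Souriau form is split if `g` is: the component
of `E v` with index `d` is determined by its products with the tangent vectors of that factor. -/
theorem isSplitEnd_of_form {g : Tensor2 ι} {m : ι → Sl2 → Sl2 → Sl2 → ℝ} (hg : IsRiemannian g)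
    (hm : IsSplitMetric g m) {E : EndField ι} {k : ℝ} {c : ℂ}
    (hE : ∀ X ∈ orbit ι, ∀ A B : V ι, g X (E X (xi A X)) (xi B X) = (c * ip k (br A B) X).re) :
    IsSplitEnd E := by
  have key : ∀ X ∈ orbit ι, ∀ (v : T X) (d : ι) (b : Sl2),
      m d (X d) ((E X v : V ι) d) ⁅b, X d⁆ = (c * -ip k (fun _ : Unit => b)
        (fun _ : Unit => (v : V ι) d)).re := by
    intro X hX v d b
    obtain ⟨A, rfl⟩ := exists_xi v
    have h1 := hE X hX A (Pi.single d b)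
    rw [hm.eq_sum X hX, xi_single, Finset.sum_eq_single d, Pi.single_eq_same, ip_br_eq] at h1
    · rw [h1, ip_eq_sum, Finset.sum_eq_single d, ip_eq_sum]
      · simp [xi]
      · intro e _ he
        simp [Pi.single_eq_of_ne he]
      · simp
    · intro e _ he
      rw [Pi.single_eq_of_ne he, hm.zero_right]
    · simp
  intro d X hX X' hX' hXX' v v' hv
  -- the difference `y` of the two components is tangent, and `m d` vanishes on `(y, y)`
  obtain ⟨A, hA⟩ := exists_xi (E X v)
  obtain ⟨A', hA'⟩ := exists_xi (E X' v')
  have hu : (E X v : V ι) d = ⁅A d, X d⁆ := by rw [hA]; rfl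
  have hu' : (E X' v' : V ι) d = ⁅A' d, X d⁆ := by rw [hA', hXX']; rfl
  have hgm : ∀ a b, g X (xi (Pi.single d a) X) (xi (Pi.single d b) X) =
      m d (X d) ⁅a, X d⁆ ⁅b, X d⁆ := fun a b => by
    rw [hm.eq_sum X hX, xi_single, xi_single, Finset.sum_eq_single d, Pi.single_eq_same, Pi.single_eq_same]
    · intro e _ he
      rw [Pi.single_eq_of_ne he, hm.zero_left]
    · simp
  have hsame : ∀ b, g X (xi (Pi.single d (A d)) X) (xi (Pi.single d b) X) =
      g X (xi (Pi.single d (A' d)) X) (xi (Pi.single d b) X) := fun b => by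
    rw [hgm, hgm, ← hu, ← hu', key X hX]
    rw [hXX', key X' hX', hv]
  set y : T X := xi (Pi.single d (A d)) X - xi (Pi.single d (A' d)) X with hy
  have hyy : g X y y = 0 := by
    rw [hy, map_sub, map_sub, LinearMap.sub_apply, LinearMap.sub_apply, hsame, hsame]
    ring
  have hy0 : y = 0 := by
    by_contra hne
    exact (hg.pos X hX y hne).ne' hyy
  have h1 := congrArg (fun v : T X => (v : V ι) d) (sub_eq_zero.1 (hy.symm.trans hy0))
  simp only [xi_single, Pi.single_eq_same] at h1
  rw [hu, hu', h1]

end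

section

/-! ### Kähler potentials and the variables `η_d` -/

variable {ι : Type} [Fintype ι] [DecidableEq ι]

theorem HyperKahler.IsKahlerPotential.congr {H : HyperKahler ι} (hI : ∀ X ∈ orbit ι, H.I X = natI X)
    {ρ ρ' : V ι → ℝ} (hρ : H.IsKahlerPotential ρ) (h : Set.EqOn ρ' ρ (orbit ι)) :
    H.IsKahlerPotential ρ' := by
  have hs : SmoothFn ρ' := hρ.1.congr h
  refine ⟨hs, fun X hX A B => ?_⟩
  have h2 : ∀ C D : V ι, lieD C (lieD D ρ') X = lieD C (lieD D ρ) X := fun C D =>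
    lieD_congr (fun Y hY => lieD_congr h hY D) hX C
  rw [hρ.2 X hX A B, dId_eq_lieD hI hρ.1 A B hX, dId_eq_lieD hI hs A B hX, h2, h2,
    lieD_congr h hX]

theorem I_xi {H : HyperKahler ι} (hI : ∀ X ∈ orbit ι, H.I X = natI X) {X : V ι} (hX : X ∈ orbit ι)
    (A : V ι) : H.I X (xi A X) = xi (Complex.I • A) X := by
  rw [hI X hX, natI_xi]

theorem isKahlerPotential_comp_etas {k : ℝ} (hk : 0 < k) {H : HyperKahler ι}
    (hI : ∀ X ∈ orbit ι, H.I X = natI X) {f : (ι → ℝ) → ℝ} (hf : ContDiffOn ℝ ∞ f (pos ι))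
    (hg : ∀ X ∈ orbit ι, ∀ v w : T X, H.g X v w = metForm k f X v w) :
    H.IsKahlerPotential fun X => f (etas k X) := by
  refine ⟨smoothFn_comp_etas hk hf, fun X hX A B => ?_⟩
  have h : br A X = -(Complex.I • br (Complex.I • A) X) := by
    rw [show br (Complex.I • A) X = Complex.I • br A X from (adMap X).map_smul Complex.I A,
      smul_smul, Complex.I_mul_I, neg_smul, one_smul, neg_neg]
  rw [dId_comp_etas hk hI hf A B hX, I_xi hI hX, hg X hX, h, potForm_I_smul]
  rfl

/-- The first derivatives of a potential in the variables `η_d` are determined by its metric. -/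
theorem exists_metForm_eq_pd {k : ℝ} (hk : 0 < k) {t : ι → ℝ} (ht : t ∈ pos ι) (j : ι) :
    ∃ X ∈ orbit ι, ∃ (v : T X) (r : ℝ), r ≠ 0 ∧ ∀ f, metForm k f X v v = r * pd j f t := by
  obtain ⟨a, ha, hat, hX, hη⟩ := exists_basePoint hk ht
  refine ⟨basePoint a, hX, xi (Pi.single j (mk 0 0 1)) (basePoint a), 16 * k ^ 2 * a j ^ 2, ?_,
    fun f => ?_⟩
  · have := ha j
    positivity
  · have hv : ((xi (Pi.single j (mk 0 0 1)) (basePoint a) : T (basePoint a)) : V ι) =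
        Pi.single j (mk (-(a j : ℂ)) 0 0) := by
      change br (Pi.single j (mk 0 0 1)) (basePoint a) = _
      rw [br_single_basePoint, lie_mk_basePoint]
      simp
    have h1 : herm k (mk (-(a j : ℂ)) 0 0) (mk (-(a j : ℂ)) 0 0) =
        ((8 * k ^ 2 * a j ^ 2 : ℝ) : ℂ) := by
      rw [herm_mk]
      simp
      ring
    have h2 : herm k (mk (-(a j : ℂ)) 0 0) (basePoint a j) = 0 := by
      rw [herm_mk]
      simp [basePoint]
    rw [hv, metForm_single, hη, Pi.single_eq_same, h1, h2, Complex.ofReal_re, Complex.zero_im,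
      Complex.zero_re]
    ring

theorem nsq_mulVec {u : Matrix.SpecialLinearGroup (Fin 2) ℂ}
    (hu : u.1 ∈ Matrix.specialUnitaryGroup (Fin 2) ℂ) (z : Fin 2 → ℂ) :
    nsq (u.1.mulVec z) = nsq z := by
  have h : ∀ w : Fin 2 → ℂ, ((nsq w : ℝ) : ℂ) = dotProduct (star w) w := fun w => by
    rw [nsq, Complex.ofReal_add, Complex.normSq_eq_conj_mul_self, Complex.normSq_eq_conj_mul_self]
    simp [dotProduct, Fin.sum_univ_two]
  have hun : u.1.conjTranspose * u.1 = 1 := Matrix.mem_unitaryGroup_iff'.1 hu.1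
  have h1 : ((nsq (u.1.mulVec z) : ℝ) : ℂ) = ((nsq z : ℝ) : ℂ) := by
    rw [h, h, Matrix.star_mulVec, Matrix.dotProduct_mulVec, Matrix.vecMul_vecMul, hun,
      Matrix.vecMul_one]
  exact_mod_cast h1

theorem etas_Ad (k : ℝ) {U : ι → Matrix.SpecialLinearGroup (Fin 2) ℂ} (hU : InSU2 U) {X : V ι}
    (hX : X ∈ orbit ι) : etas k (Ad U X) = etas k X := by
  obtain ⟨z, hz, rfl⟩ := exists_spin_of_mem_orbit hX
  rw [← spin_act]
  funext d
  change etaOne k (spinOne ((U d).1.mulVec (z d))) = etaOne k (spinOne (z d))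
  rw [etaOne_spinOne, etaOne_spinOne, nsq_mulVec (hU d)]

theorem oneMet_zero_left (k : ℝ) (F : ℝ → ℝ) (x w : Sl2) : oneMet k F x 0 w = 0 := by
  simp [oneMet]

theorem oneMet_zero_right (k : ℝ) (F : ℝ → ℝ) (x v : Sl2) : oneMet k F x v 0 = 0 := by
  simp [oneMet]

theorem smoothFn_ip (k : ℝ) (A : V ι) (c : ℂ) : SmoothFn fun X => (c * ip k A X).re := by
  have he := fun (d : ι) (i j : Fin 2) => contDiff_entry d i j (n := ∞)
  have h : ContDiff ℝ ∞ fun X : V ι => ip k A X := by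
    simp only [ip_eq_sum]
    exact ContDiff.sum fun d _ => (contDiff_const.mul (((contDiff_const.mul (he d 0 0)).add
      (contDiff_const.mul (he d 1 0))).add (contDiff_const.mul (he d 0 1)))).neg
  exact (Complex.reCLM.contDiff.comp (contDiff_const.mul h)).contDiffOn

theorem isSplitEnd_of_eq_natI {E : EndField ι} (hE : ∀ X ∈ orbit ι, E X = natI X) :
    IsSplitEnd E := by
  intro d X hX X' hX' _ v v' hv
  rw [hE X hX, hE X' hX']
  exact congrArg (fun x => Complex.I • x) hv

/-! ### Classification of the invariant compatible structures with a potential -/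

/-- A compatible hyperKähler structure whose metric has a potential `f(η)`: the function `f` is a
sum of solutions of the differential equation, one for each variable. -/
theorem exists_separated_potential {k : ℝ} (hk : 0 < k) {H : HyperKahler ι}
    (hKKS : H.IsKKSCompatible k) {f : (ι → ℝ) → ℝ} (hf : ContDiffOn ℝ ∞ f (pos ι))
    (hpot : H.IsKahlerPotential fun X => f (etas k X)) :
    ∃ (F : ι → ℝ → ℝ) (C : ℝ), (∀ d, ContDiffOn ℝ ∞ (F d) (Set.Ioi 0)) ∧
      (∀ t ∈ pos ι, f t = ∑ d, F d (t d) + C) ∧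
      ∀ d s, 0 < s → 0 < deriv (F d) s ∧
        2 * s * deriv (F d) s * (deriv (F d) s + s * deriv (deriv (F d)) s) = k ^ 2 := by
  have heq := fun t (ht : t ∈ pos ι) d => potential_equations hk hKKS hf hpot ht d
  have hF := contDiffOn_oneVar hf
  obtain ⟨C, hC⟩ := eq_sum_oneVar hf fun t ht d m hm => (heq t ht d).2.1 m hm
  refine ⟨oneVar f, C, hF, hC, fun d s hs => ?_⟩
  have h1 : ∀ t ∈ pos ι, pd d f t = deriv (oneVar f d) (t d) := fun t ht => by
    rw [pd_congr hC d ht, pd_separated hF C d ht]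
  have ht := update_mem_pos d hs
  have h2 := pd_congr h1 d ht
  rw [pd_comp_eval (contDiffOn_deriv_of_pos hF) d d ht, if_pos rfl] at h2
  obtain ⟨e1, -, e3⟩ := heq _ ht d
  rw [h2, h1 _ ht, Function.update_self] at e3
  rw [h1 _ ht, Function.update_self] at e1
  exact ⟨e1, e3⟩

/-- The classification for an arbitrary number of factors. -/
theorem classification {k : ℝ} (hk : 0 < k) {H : HyperKahler ι} (hinv : H.IsInvariant)
    (hKKS : H.IsKKSCompatible k) (hpot : ∃ ρ : V ι → ℝ, H.IsKahlerPotential ρ) :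
    ∃ (S : ι → HyperKahler Unit) (c : ι → ℝ) (F : ι → ℝ → ℝ),
      H.IsProduct S ∧
      (∀ d, (S d).IsInvariant ∧ (S d).IsKKSCompatible k) ∧
      (∀ d, 0 ≤ c d) ∧
      (∀ d, ∀ X ∈ orbit Unit, ∀ v w : T X, (S d).g X v w = explicitMetric k (c d) X v w) ∧
      (∀ d, ContDiffOn ℝ ∞ (F d) (Set.Ioi 0)) ∧
      (∀ d, (S d).IsKahlerPotential (fun X => F d (eta k X))) ∧
      (∀ d, ∀ t : ℝ, 0 < t → deriv (F d) t ^ 2 = (k ^ 2 * t + c d / 4) / t ^ 2) ∧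
      (∀ ρ : V ι → ℝ, (H.IsKahlerPotential ρ ∧ InvariantFn ρ) ↔
        ∃ C : ℝ, ∀ X ∈ orbit ι, ρ X = ∑ d, F d (eta k (comp d X)) + C) := by
  have hI := hKKS.1
  obtain ⟨ρ₀, hρ₀⟩ := hpot
  -- every invariant potential is a smooth function of the variables `η_d`
  have hprof : ∀ ρ : V ι → ℝ, H.IsKahlerPotential ρ → InvariantFn ρ →
      ContDiffOn ℝ ∞ (profile k ρ) (pos ι) ∧
        H.IsKahlerPotential fun X => profile k ρ (etas k X) := fun ρ hρ hρi =>
    ⟨contDiffOn_profile hk hρ.1.contDiffOn_comp_spin,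
      hρ.congr hI fun X hX => (hρi.eq_profile hk hX).symm⟩
  -- the average of the given potential is an invariant potential
  obtain ⟨hf, hfpot⟩ := hprof _ (isKahlerPotential_avg H hinv hI hρ₀) (avg_invariant ρ₀)
  set f := profile k (avg ρ₀)
  obtain ⟨F, C, hF, hC, hode⟩ := exists_separated_potential hk hKKS hf hfpot
  have hg : ∀ X ∈ orbit ι, ∀ v w : T X, H.g X v w = metForm k f X v w := fun X hX =>
    metric_eq_metForm hk hI hf hfpot hX
  have hm : IsSplitMetric H.g fun d => oneMet k (F d) :=
    ⟨fun X hX v w => by rw [hg X hX, metForm_separated hk hF C hC hX],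
      fun d => oneMet_zero_left k (F d), fun d => oneMet_zero_right k (F d)⟩
  have hreJ : ∀ X ∈ orbit ι, ∀ A B : V ι,
      H.g X (H.J X (xi A X)) (xi B X) = (1 * ip k (br A B) X).re := fun X hX A B => by
    rw [one_mul, hKKS.2 X hX]
    simp
  have himK : ∀ X ∈ orbit ι, ∀ A B : V ι,
      H.g X (H.K X (xi A X)) (xi B X) = (-Complex.I * ip k (br A B) X).re := fun X hX A B => by
    rw [hKKS.2 X hX]
    simp
  have hsI : ∀ A B, SmoothFn fun X => H.g X (H.I X (xi A X)) (xi B X) := fun A B =>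
    (H.riemannian.smooth (Complex.I • A) B).congr fun X hX => by
      dsimp only
      rw [I_xi hI hX]
  have hsJ : ∀ A B, SmoothFn fun X => H.g X (H.J X (xi A X)) (xi B X) := fun A B =>
    (smoothFn_ip k (br A B) 1).congr fun X hX => hreJ X hX A B
  have hsK : ∀ A B, SmoothFn fun X => H.g X (H.K X (xi A X)) (xi B X) := fun A B =>
    (smoothFn_ip k (br A B) (-Complex.I)).congr fun X hX => himK X hX A B
  have hSI := isSplitEnd_of_eq_natI hI
  have hSJ := isSplitEnd_of_form H.riemannian hm hreJ
  have hSK := isSplitEnd_of_form H.riemannian hm himK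
  choose c hc0 hc using fun d => exists_integration_constant hk (hF d) fun s hs => (hode d s hs).2
  refine ⟨H.restrict hm hSI hSJ hSK hsI hsJ hsK, c, F,
    isProduct_restrict hm hSI hSJ hSK hsI hsJ hsK,
    fun d => ⟨isInvariant_restrict hm hSI hSJ hSK hsI hsJ hsK hinv d,
      isKKSCompatible_restrict hm hSI hSJ hSK hsI hsJ hsK hKKS d⟩, hc0, ?_, hF, ?_, ?_, ?_⟩
  · intro d X hX v w
    have hη : 0 < eta k X := by
      rw [eta_unit]
      exact etaOne_pos hk (ne_zero_of_mem_orbit hX ())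
    exact (hm.resMet_eq d hX v w).trans
      (oneMet_eq_explicitMetric X v w hη (hode d _ hη).1 (hc d _ hη) (hode d _ hη).2)
  · intro d
    have hF' : ∀ _ : Unit, ContDiffOn ℝ ∞ (F d) (Set.Ioi 0) := fun _ => hF d
    have hsum : ∀ t : Unit → ℝ, F d (t ()) = ∑ u, F d (t u) + 0 := fun t => by simp
    have h := isKahlerPotential_comp_etas hk
      (isKKSCompatible_restrict hm hSI hSJ hSK hsI hsJ hsK hKKS d).1
      (contDiffOn_comp_eval hF' ()) fun X hX v w => by
        rw [metForm_separated hk hF' 0 (fun t _ => hsum t) hX]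
        exact (hm.resMet_eq d hX v w).trans (Fintype.sum_unique
            fun u => oneMet k (F d) (X u) ((v : V Unit) u) ((w : V Unit) u)).symm
    simpa only [etas, ← eta_unit] using h
  · intro d t ht
    rw [eq_div_iff (by positivity), ← hc d t ht]
    ring
  · intro ρ
    simp only [eta_comp]
    constructor
    · rintro ⟨hρ, hρi⟩
      -- both potentials give the metric `g`, so their derivatives in the variables `η_d` agree
      obtain ⟨hf', hfpot'⟩ := hprof ρ hρ hρi
      obtain ⟨C', hC'⟩ := eq_add_const_of_pd_eq hf' hf fun t ht d => by
        obtain ⟨X, hX, v, r, hr, hmet⟩ := exists_metForm_eq_pd hk ht d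
        apply mul_left_cancel₀ hr
        rw [← hmet, ← hmet, ← hg X hX, metric_eq_metForm hk hI hf' hfpot' hX]
      refine ⟨C + C', fun X hX => ?_⟩
      have hη := etas_mem_pos hk hX
      rw [hρi.eq_profile hk hX, hC' _ hη, hC _ hη, add_assoc]
      rfl
    · rintro ⟨C', hC'⟩
      refine ⟨?_, fun U hU X hX => ?_⟩
      · have h := isKahlerPotential_comp_etas hk hI (contDiffOn_separated hF C') fun X hX v w => by
          rw [hm.eq_sum X hX, metForm_separated hk hF C' (fun _ _ => rfl) hX]
        exact h.congr hI fun X hX => hC' X hX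
      · have h := etas_Ad k hU hX
        have h1 : ∀ d, etaOne k (Ad U X d) = etaOne k (X d) := fun d => congrFun h d
        rw [hC' X hX, hC' _ (Ad_mem_orbit U hX)]
        simp only [h1]

end

end NilOrbit

end

theorem mainTheorem3 (k : ℝ) (hk : 0 < k) (H : NilOrbit.HyperKahler (Fin 3))
    (hinv : H.IsInvariant) (hKKS : H.IsKKSCompatible k)
    (hpot : ∃ ρ : NilOrbit.V (Fin 3) → ℝ, H.IsKahlerPotential ρ) :
    ∃ (S : Fin 3 → NilOrbit.HyperKahler Unit) (c : Fin 3 → ℝ) (F : Fin 3 → ℝ → ℝ),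
      -- `H` is a product of invariant compatible hyperKähler structures on the factors
      H.IsProduct S ∧
      (∀ d, (S d).IsInvariant ∧ (S d).IsKKSCompatible k) ∧
      -- each factor is the member with parameter `c d ≥ 0` of the explicit family
      (∀ d, 0 ≤ c d) ∧
      (∀ d, ∀ X ∈ NilOrbit.orbit Unit, ∀ v w : NilOrbit.T X,
        (S d).g X v w = NilOrbit.explicitMetric k (c d) X v w) ∧
      -- each factor has a potential `F d` in the variable `η`, with the stated derivative
      (∀ d, ContDiffOn ℝ ∞ (F d) (Set.Ioi 0)) ∧
      (∀ d, (S d).IsKahlerPotential (fun X => F d (NilOrbit.eta k X))) ∧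
      (∀ d, ∀ t : ℝ, 0 < t → deriv (F d) t ^ 2 = (k ^ 2 * t + c d / 4) / t ^ 2) ∧
      -- the invariant potentials of `H` are the sum of these functions, up to a constant
      (∀ ρ : NilOrbit.V (Fin 3) → ℝ,
        (H.IsKahlerPotential ρ ∧ NilOrbit.InvariantFn ρ) ↔
          ∃ C : ℝ, ∀ X ∈ NilOrbit.orbit (Fin 3),
            ρ X = ∑ d, F d (NilOrbit.eta k (NilOrbit.comp d X)) + C) :=
  NilOrbit.classification hk hinv hKKS hpot
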